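/- **Graphs.** A (canonical) ADMG $G$ on a finite vertex set $V$ consists of directed edges $j\to k$ and symmetric bidirected edges $j\leftrightarrow k$ such that all bidirected loops $j\leftrightarrow j$ are present and there is no directed cycle. A path is a walk without repeated vertices; a non-endpoint of a walk is a collider if both adjacent edges have an arrowhead at it. For an ADMG $G'$ on a finite set $V'\supseteq V$, the marginal $\mathrm{marg}_V(G')$ is the ADMG on $V$ in which, for $j\ne k$, $j\to k$ iff $G'$ has a directed path from $j$ to $k$ with no non-endpoint in $V$, and $j\leftrightarrow k$ iff $G'$ has a path from $j$ to $k$ with no collider, with arrowheads at both ends, and with no non-endpoint in $V$. A vertex is exogenous if it has no parents; $G'$ is unconfounded if $j\leftrightarrow k$, $j\neq k$, implies that $j$ and $k$ are both exogenous. Let $\exp(G)$ be the class of ADMGs $G'$ on finite sets $V'\supseteq V$ with $\mathrm{marg}_V(G')=G$, and $\exp_U(G)$ the subclass of unconfounded ones. The noise expansion $\exp_N(G)$ has vertex set $V\sqcup\{E_j:j\in V\}$ and the edges $E_j\to j$; $E_j\leftrightarrow E_k$ whenever $j\leftrightarrow k$ in $G$; $j\to k$ whenever $j\to k$ in $G$;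 and all bidirected loops. **Models.** Let $\mathbb V=\prod_{j\in V}\mathbb V_j$ with standard Borel spaces $\mathbb V_j$ (e.g. Borel subsets of $\mathbb R^{n_j}$). The model $\mathbb P_E(G,\mathbb V)$ is the set of probability distributions on $\mathbb V$ of random vectors $(V_j)_{j\in V}$ for which there are a random vector $(E_j)_{j\in V}$ in $[0,1]^V$ on the same probability space and measurable functions $f_j$ such that almost surely $V_j=f_j(V_{\mathrm{pa}_G(j)},E_j)$ for all $j$, and such that $E_J$ and $E_K$ are independent for all disjoint $J,K\subseteq V$ with no bidirected edge of $G$ between $J$ and $K$. The global Markov model $\mathbb P_{GM}(G,\mathbb V)$ is the set of probability distributions on $\mathbb V$ under which $V_J$ and $V_K$ are conditionally independent given $V_L$ for all disjoint $J,K,L\subseteq V$ such that $J$ and $K$ are m-separated by $L$ in $G$ (that is, no walk from $J$ to $K$ has all of its colliders in $L$ and all of its other non-endpoints outside $L$). On distributions, $\mathrm{marg}_V$ takes the marginal distribution of the $V$-coordinates. Put $\mathbb P_{NE}(G,\mathbb V)=\mathrm{marg}_V\big(\mathbb P_{GM}(\exp_N(G),\mathbb V\times[0,1]^{|V|})\big)$.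 **Proposition.** For every ADMG $G$ on $V$ and every such $\mathbb V$, $$\begin{aligned}\mathbb P_E(G,\mathbb V)&=\mathrm{marg}_V\big(\mathbb P_E(\exp_N(G),\mathbb V\times[0,1]^{|V|})\big)\\&=\bigcup_{G'\in\exp_U(G)}\mathrm{marg}_V\big(\mathbb P_E(G',\mathbb V\times[0,1]^{|V(G')|-|V|})\big)\\&=\bigcup_{G'\in\exp(G)}\mathrm{marg}_V\big(\mathbb P_E(G',\mathbb V\times[0,1]^{|V(G')|-|V|})\big).\end{aligned}$$ In particular the E model is complete with respect to unconfounded expansions; so is the NE model: $$\mathbb P_{NE}(G,\mathbb V)=\bigcup_{G'\in\exp_U(G)}\mathrm{marg}_V\big(\mathbb P_{NE}(G',\mathbb V\times[0,1]^{|V(G')|-|V|})\big).$$ For any $\sigma$-finite reference measures $\mu_j$ on $\mathbb V_j$, all four identities also hold when every model is restricted to those distributions under which the observed vector $(V_j)_{j\in V}$ has a density with respect to $\bigotimes_{j\in V}\mu_j$. -/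

import Mathlib

open MeasureTheory ProbabilityTheory

universe u

/-! ### Canonical acyclic directed mixed graphs -/

/-- A canonical ADMG with vertex set `V`: directed edges `dir j k` (`j → k`), symmetric bidirected
edges `bi j k` (`j ↔ k`), all bidirected loops, and no directed cycle. -/
structure ADMG (V : Type u) where
  dir : V → V → Prop
  bi : V → V → Prop
  bi_symm : ∀ j k, bi j k → bi k j
  bi_refl : ∀ j, bi j j
  acyclic : ∀ j, ¬ Relation.TransGen dir j j

/-- The three ways in which a walk can traverse an edge: `a → b`, `a ← b`, `a ↔ b`. -/
inductive EdgeKind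
  | right
  | left
  | both

/-- The edge has an arrowhead at the vertex where the traversal starts. -/
def EdgeKind.HeadAtStart : EdgeKind → Prop
  | .right => False
  | .left => True
  | .both => True

/-- The edge has an arrowhead at the vertex where the traversal ends. -/
def EdgeKind.HeadAtEnd : EdgeKind → Prop
  | .right => True
  | .left => False
  | .both => True

namespace ADMG

variable {V : Type u}

/-- `G.HasEdge e a b`: the graph contains the edge `a → b`, `a ← b` or `a ↔ b`, as `e` says. -/
def HasEdge (G : ADMG V) : EdgeKind → V → V → Prop
  | .right, a, b => G.dir a b
  | .left, a, b => G.dir b a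
  | .both, a, b => G.bi a b

/-- `G.IsWalk a w b`: the list `w = [(e₁, c₁), …, (eₙ, cₙ)]` is a walk
`a —e₁— c₁ —e₂— ⋯ —eₙ— cₙ = b` in `G`. -/
def IsWalk (G : ADMG V) : V → List (EdgeKind × V) → V → Prop
  | a, [], b => a = b
  | a, (e, c) :: w, b => G.HasEdge e a c ∧ G.IsWalk c w b

/-- A path is a walk on which no vertex is repeated. -/
def IsPath (G : ADMG V) (a : V) (w : List (EdgeKind × V)) (b : V) : Prop :=
  G.IsWalk a w b ∧ (a :: w.map Prod.snd).Nodup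

/-- For two successive steps `s`, `t` of a walk: the vertex between them is a collider. -/
def Collider (s t : EdgeKind × V) : Prop := s.1.HeadAtEnd ∧ t.1.HeadAtStart

/-- No non-endpoint of the walk `w` lies in `J`. -/
def InteriorAvoids (J : Set V) (w : List (EdgeKind × V)) : Prop :=
  w.IsChain (fun s _ => s.2 ∉ J)

/-- There is a directed path `a → ⋯ → b` with no non-endpoint in `J`. -/
def DirectedPathAvoiding (G : ADMG V) (J : Set V) (a b : V) : Prop :=
  ∃ w, G.IsPath a w b ∧ (∀ s ∈ w, s.1 = EdgeKind.right) ∧ InteriorAvoids J w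

/-- There is a confounding arc from `a` to `b` (a path without colliders and with arrowheads at
both of its ends) with no non-endpoint in `J`. -/
def ConfoundingArcAvoiding (G : ADMG V) (J : Set V) (a b : V) : Prop :=
  ∃ w, G.IsPath a w b ∧ w.IsChain (fun s t => ¬ Collider s t) ∧
    (∀ s ∈ w.head?, s.1.HeadAtStart) ∧ (∀ s ∈ w.getLast?, s.1.HeadAtEnd) ∧ InteriorAvoids J w

/-- `G` (on `V`) is the `V`-marginal (latent projection) of `G'`, whose vertex set is `V` together
with a set `L` of latent vertices.  (Pairs `j = k` need no clause: in an ADMG there are no directed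
loops and all bidirected loops.) -/
def IsMarginal {L : Type u} (G' : ADMG (V ⊕ L)) (G : ADMG V) : Prop :=
  ∀ j k : V, j ≠ k →
    (G.dir j k ↔ G'.DirectedPathAvoiding (Set.range Sum.inl) (Sum.inl j) (Sum.inl k)) ∧
    (G.bi j k ↔ G'.ConfoundingArcAvoiding (Set.range Sum.inl) (Sum.inl j) (Sum.inl k))

/-- The ADMG expansions of `G` with latent vertex set `L`. -/
def expansions (G : ADMG V) (L : Type u) : Set (ADMG (V ⊕ L)) := {G' | G'.IsMarginal G}

/-- A vertex without parents. -/
def Exogenous (G : ADMG V) (j : V) : Prop := ∀ k, ¬ G.dir k j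

/-- Distinct vertices joined by a bidirected edge are exogenous. -/
def Unconfounded (G : ADMG V) : Prop :=
  ∀ j k, j ≠ k → G.bi j k → G.Exogenous j ∧ G.Exogenous k

/-- The unconfounded expansions of `G` with latent vertex set `L`. -/
def unconfoundedExpansions (G : ADMG V) (L : Type u) : Set (ADMG (V ⊕ L)) :=
  {G' | G' ∈ G.expansions L ∧ G'.Unconfounded}

/-- Directed edges of the noise expansion: `j → k` as in `G`, and `E_j → j`. Here `Sum.inl j` is
the vertex `j` and `Sum.inr j` its noise vertex `E_j`. -/
def noiseDir (G : ADMG V) : V ⊕ V → V ⊕ V → Prop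
  | .inl j, .inl k => G.dir j k
  | .inr j, .inl k => j = k
  | _, .inr _ => False

/-- Bidirected edges of the noise expansion: `E_j ↔ E_k` iff `j ↔ k` in `G`, and the loops. -/
def noiseBi (G : ADMG V) : V ⊕ V → V ⊕ V → Prop
  | .inl j, .inl k => j = k
  | .inr j, .inr k => G.bi j k
  | _, _ => False

/-- A directed walk of the noise expansion that starts at a vertex of `G` is one of `G`. -/
theorem noiseDir_transGen (G : ADMG V) {j : V} {y : V ⊕ V}
    (h : Relation.TransGen G.noiseDir (Sum.inl j) y) :
    ∃ k, y = Sum.inl k ∧ Relation.TransGen G.dir j k := by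
  induction h with
  | @single b hb =>
    cases b with
    | inl k => exact ⟨k, rfl, .single hb⟩
    | inr k => exact hb.elim
  | @tail b c _ hbc ih =>
    obtain ⟨k, rfl, hk⟩ := ih
    cases c with
    | inl l => exact ⟨l, rfl, hk.tail hbc⟩
    | inr l => exact hbc.elim

/-- The noise expansion of `G`. -/
def noiseExpansion (G : ADMG V) : ADMG (V ⊕ V) where
  dir := G.noiseDir
  bi := G.noiseBi
  bi_symm := by
    rintro (j | j) (k | k) h
    · exact Eq.symm h
    · exact h.elim
    · exact h.elim
    · exact G.bi_symm _ _ h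
  bi_refl := by
    rintro (j | j)
    · exact rfl
    · exact G.bi_refl j
  acyclic := by
    rintro (j | j) h
    · obtain ⟨k, hk, h'⟩ := G.noiseDir_transGen h
      cases hk
      exact G.acyclic _ h'
    · obtain ⟨b, _, hb⟩ := Relation.TransGen.tail'_iff.1 h
      cases b <;> exact hb.elim

/-- `J` and `K` are m-connected given `L`: some walk from a vertex of `J` to a vertex of `K` is not
blocked by `L`, that is, all its colliders are in `L` and none of its other non-endpoints is. -/
def MConnected (G : ADMG V) (J K L : Set V) : Prop :=
  ∃ j ∈ J, ∃ k ∈ K, ∃ w, G.IsWalk j w k ∧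
    w.IsChain (fun s t => (Collider s t → s.2 ∈ L) ∧ (¬ Collider s t → s.2 ∉ L))

end ADMG

/-! ### State spaces and marginal distributions -/

instance unitInterval_standardBorelSpace : StandardBorelSpace unitInterval :=
  inferInstanceAs (StandardBorelSpace (Set.Icc (0 : ℝ) 1))

/-- The state space of the observed vertices `V` (values in `X v`) together with latent vertices `L`
(values in `[0,1]`): the coordinates of `𝕍 × [0,1]^L`. -/
def ExtSpace {V : Type u} (X : V → Type) (L : Type u) : V ⊕ L → Type
  | .inl v => X v
  | .inr _ => unitInterval

instance ExtSpace.measurableSpace {V : Type u} (X : V → Type) [m : ∀ v, MeasurableSpace (X v)]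
    (L : Type u) : ∀ i, MeasurableSpace (ExtSpace X L i)
  | .inl v => m v
  | .inr _ => inferInstanceAs (MeasurableSpace unitInterval)

instance ExtSpace.standardBorelSpace {V : Type u} (X : V → Type) [∀ v, MeasurableSpace (X v)]
    [s : ∀ v, StandardBorelSpace (X v)] (L : Type u) :
    ∀ i, StandardBorelSpace (ExtSpace X L i)
  | .inl v => s v
  | .inr _ => inferInstanceAs (StandardBorelSpace unitInterval)

/-- The projection `𝕍 × [0,1]^L → 𝕍`. -/
def restrictObserved {V : Type u} (X : V → Type) (L : Type u) (x : ∀ i, ExtSpace X L i) (v : V) :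
    X v := x (Sum.inl v)

theorem measurable_restrictObserved {V : Type u} (X : V → Type) [∀ v, MeasurableSpace (X v)]
    (L : Type u) : Measurable (restrictObserved X L) :=
  measurable_pi_lambda _ fun v => measurable_pi_apply (X := ExtSpace X L) (Sum.inl v)

/-- The `V`-marginal of a probability distribution on `𝕍 × [0,1]^L`. -/
noncomputable def margV {V : Type u} {X : V → Type} [∀ v, MeasurableSpace (X v)] {L : Type u}
    (P : ProbabilityMeasure (∀ i, ExtSpace X L i)) : ProbabilityMeasure (∀ v, X v) :=
  P.map (measurable_restrictObserved X L).aemeasurable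

/-- `P` has a density function with respect to the product of the measures `μ v`. -/
def HasDensity {V : Type u} [Fintype V] {X : V → Type} [∀ v, MeasurableSpace (X v)]
    (μ : ∀ v, Measure (X v)) (P : ProbabilityMeasure (∀ v, X v)) : Prop :=
  ∃ p : (∀ v, X v) → ENNReal, Measurable p ∧
    (P : Measure (∀ v, X v)) = (Measure.pi μ).withDensity p

/-! ### The statistical models -/

namespace ADMG

variable {V : Type u}

/-- A distribution `Q` of the noise vector on `[0,1]^V` is unconditionally Markov with respect to
the bidirected edges of `G`: disjoint sets of vertices with no bidirected edge between them have
independent noise subvectors. -/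
def NoiseMarkov (G : ADMG V) (Q : Measure (V → unitInterval)) : Prop :=
  ∀ J K : Set V, Disjoint J K → (∀ j ∈ J, ∀ k ∈ K, ¬ G.bi j k) →
    IndepFun (fun e (j : J) => e j) (fun e (k : K) => e k) Q

/-- The nonparametric equation system (E) model: the distributions `P` of random vectors `V` which,
jointly with a noise vector `E` (`ρ` is the joint distribution), satisfy almost surely
`V_j = f_j (V_{pa(j)}, E_j)` for all `j`, with measurable `f_j` and `NoiseMarkov` noise. -/
def EModel (G : ADMG V) (X : V → Type) [∀ v, MeasurableSpace (X v)] :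
    Set (ProbabilityMeasure (∀ v, X v)) :=
  {P | ∃ (f : ∀ j, (∀ k : {k // G.dir k j}, X k) × unitInterval → X j)
      (ρ : Measure ((∀ v, X v) × (V → unitInterval))),
    (∀ j, Measurable (f j)) ∧
    ρ.map Prod.fst = (P : Measure (∀ v, X v)) ∧
    G.NoiseMarkov (ρ.map Prod.snd) ∧
    ∀ᵐ z ∂ρ, ∀ j, z.1 j = f j (fun k => z.1 k, z.2 j)}

/-- The global Markov (GM) model: m-separation implies conditional independence. -/
def GMModel [Finite V] (G : ADMG V) (X : V → Type) [∀ v, MeasurableSpace (X v)]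
    [∀ v, StandardBorelSpace (X v)] : Set (ProbabilityMeasure (∀ v, X v)) :=
  {P | ∀ J K L : Set V, Disjoint J K → Disjoint J L → Disjoint K L → ¬ G.MConnected J K L →
    CondIndepFun
      (MeasurableSpace.comap (fun (x : ∀ v, X v) (l : L) => x l) inferInstance)
      (Measurable.comap_le (by fun_prop))
      (fun (x : ∀ v, X v) (j : J) => x j) (fun (x : ∀ v, X v) (k : K) => x k)
      (P : Measure (∀ v, X v))}

/-- The noise expansion (NE) model: the `V`-marginal of the global Markov model of the noise
expansion. -/
def NEModel [Finite V] (G : ADMG V) (X : V → Type) [∀ v, MeasurableSpace (X v)]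
    [∀ v, StandardBorelSpace (X v)] : Set (ProbabilityMeasure (∀ v, X v)) :=
  margV '' G.noiseExpansion.GMModel (ExtSpace X V)

end ADMG

/-!
The key facts are that the E model is preserved by marginalization, and that the NE model
coincides with the E model for every ADMG. With them, all four identities reduce to two
observations: the noise expansion is an unconfounded expansion
(`ADMG.noiseExpansion_mem_unconfoundedExpansions`), and a solution of a structural equation system
of `G`, together with its noise, lies in the E model of the noise expansion
(`ADMG.noiseLaw_mem_EModel`). A density condition on the observed vector is a condition on the
marginal distribution only, so that it may be imposed on both sides.

*Marginalization* (`ADMG.margV_mem_EModel`). By acyclicity, the equations of the latent vertices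
can be solved recursively for given observed values and noise. Substitution into the equation of
an observed vertex `j` leaves an equation whose arguments are the observed parents of the latent
ancestors of `j`, which are parents of `j` in the latent projection, and the noise variables
of the latent ancestors of `j` (with `j` among them). The latter are encoded in a single variable
with values in `[0,1]`. The new noise has the required independences because `j` and `k` are
joined by a bidirected edge of the latent projection whenever latent ancestors of theirs coincide
or are joined by a bidirected edge (`ADMG.IsMarginal.bi_of_latentAnc`).

*E model ⊆ NE model* (`ADMG.EModel_subset_NEModel`). A structural equation system together with
its noise satisfies the global Markov property with respect to the noise expansion. This is shown
by removing sinks from an ancestral vertex set (`ADMG.coordCondIndep_of_determined`): a sink on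
one side of a separation is a function of its parents, which can replace it, and a sink in the
conditioning set is a collider on every walk through it, so that without it one of the two sides
is still separated from it and can absorb it. When only noise variables are left, the
unconditional independences give the conditional ones by weak union.

*NE model ⊆ E model* (`ADMG.NEModel_subset_EModel`). The variable of a vertex is conditionally
independent of its other non-descendants given its parents in the noise expansion, and its
conditional distribution can be written as the law of `g (parents, U)` with `U` uniform on
`[0,1]`. Sampling with these functions and independent uniform variables reproduces the
distribution (`ADMG.map_sample`), and a noise variable `E_j` together with the randomization
variable `U_j` forms a new noise variable.
-/

namespace ADMG

variable {V : Type u}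

/-! ### The noise expansion is an unconfounded expansion -/

theorem noiseExpansion_dir_iff (G : ADMG V) {j k : V} (hjk : j ≠ k) :
    G.dir j k ↔ G.noiseExpansion.DirectedPathAvoiding (Set.range Sum.inl) (Sum.inl j)
      (Sum.inl k) := by
  constructor
  · intro h
    refine ⟨[(.right, .inl k)], ⟨⟨h, rfl⟩, ?_⟩, ?_, ?_⟩
    · simpa using hjk
    · simp
    · exact List.isChain_singleton _
  · rintro ⟨w, ⟨hw, -⟩, hr, hi⟩
    rcases w with - | ⟨⟨e, c⟩, w⟩
    · exact absurd (Sum.inl_injective hw) hjk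
    · obtain rfl : e = .right := hr (e, c) (by simp)
      obtain ⟨he, hw⟩ := hw
      rcases c with c | c
      · rcases w with - | ⟨s, w⟩
        · cases hw
          exact he
        · exact absurd ⟨c, rfl⟩ (List.isChain_cons_cons.1 hi).1
      · exact he.elim

theorem noiseExpansion_bi_iff (G : ADMG V) {j k : V} (hjk : j ≠ k) :
    G.bi j k ↔ G.noiseExpansion.ConfoundingArcAvoiding (Set.range Sum.inl) (Sum.inl j)
      (Sum.inl k) := by
  constructor
  · intro h
    refine ⟨[(.left, .inr j), (.both, .inr k), (.right, .inl k)],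
      ⟨⟨rfl, h, rfl, rfl⟩, ?_⟩, ?_, ?_, ?_, ?_⟩
    · simpa using hjk
    · simp [Collider, EdgeKind.HeadAtStart, EdgeKind.HeadAtEnd]
    · simp [EdgeKind.HeadAtStart]
    · simp [EdgeKind.HeadAtEnd]
    · simp [InteriorAvoids]
  · rintro ⟨w, ⟨hw, hnd⟩, hc, hs, he, hi⟩
    rcases w with - | ⟨⟨e₁, c₁⟩, w⟩
    · exact absurd (Sum.inl_injective hw) hjk
    obtain ⟨h₁, hw⟩ := hw
    rcases c₁ with c₁ | c₁
    · rcases w with - | ⟨s, w⟩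
      · cases e₁ with
        | right => exact (hs _ rfl).elim
        | left => exact (he _ rfl).elim
        | both =>
          cases h₁
          simp at hnd
      · exact absurd ⟨c₁, rfl⟩ (List.isChain_cons_cons.1 hi).1
    · obtain rfl : e₁ = .left := by
        cases e₁ with
        | right => exact h₁.elim
        | left => rfl
        | both => exact h₁.elim
      obtain rfl : c₁ = j := h₁
      rcases w with - | ⟨⟨e₂, c₂⟩, w⟩
      · cases hw
      obtain ⟨h₂, hw⟩ := hw
      cases e₂ with
      | left => rcases c₂ with c₂ | c₂ <;> exact h₂.elim
      | right =>
        rcases c₂ with c₂ | c₂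
        · cases h₂
          simp at hnd
        · exact h₂.elim
      | both =>
        rcases c₂ with c₂ | c₂
        · exact h₂.elim
        rcases w with - | ⟨⟨e₃, c₃⟩, w⟩
        · cases hw
        obtain ⟨h₃, hw⟩ := hw
        have hc₃ := (List.isChain_cons_cons.1 (List.isChain_cons_cons.1 hc).2).1
        cases e₃ with
        | left => exact (hc₃ ⟨trivial, trivial⟩).elim
        | both => exact (hc₃ ⟨trivial, trivial⟩).elim
        | right =>
          rcases c₃ with c₃ | c₃
          · obtain rfl : c₂ = c₃ := h₃
            rcases w with - | ⟨s, w⟩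
            · cases hw
              exact h₂
            · exact absurd ⟨c₂, rfl⟩ (List.isChain_cons_cons.1
                (List.isChain_cons_cons.1 (List.isChain_cons_cons.1 hi).2).2).1
          · exact h₃.elim

theorem noiseExpansion_mem_unconfoundedExpansions (G : ADMG V) :
    G.noiseExpansion ∈ G.unconfoundedExpansions V := by
  refine ⟨fun j k hjk => ⟨G.noiseExpansion_dir_iff hjk, G.noiseExpansion_bi_iff hjk⟩, ?_⟩
  rintro (j | j) (k | k) hjk h
  · exact absurd (congrArg Sum.inl h) hjk
  · exact h.elim
  · exact h.elim
  · constructor <;> rintro (l | l) h' <;> exact h'.elim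

/-! ### Latent ancestors and latent projections -/

theorem wellFounded_dir [Finite V] (G : ADMG V) : WellFounded G.dir := by
  have : IsTrans V (Relation.TransGen G.dir) := ⟨fun _ _ _ => .trans⟩
  have : Std.Irrefl (Relation.TransGen G.dir) := ⟨G.acyclic⟩
  exact Subrelation.wf Relation.TransGen.single
    (Finite.wellFounded_of_trans_of_irrefl (Relation.TransGen G.dir))

theorem wellFounded_swap_transGen_dir [Finite V] (G : ADMG V) :
    WellFounded (fun a b => Relation.TransGen G.dir b a) := by
  have : IsTrans V (fun a b => Relation.TransGen G.dir b a) := ⟨fun _ _ _ h h' => .trans h' h⟩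
  have : Std.Irrefl (fun a b => Relation.TransGen G.dir b a) := ⟨G.acyclic⟩
  exact Finite.wellFounded_of_trans_of_irrefl _

variable {L : Type u} {G' : ADMG (V ⊕ L)} {a b c t : V ⊕ L}

/-- `a → b` is an edge whose tail `a` is latent. -/
def LatentDir (G' : ADMG (V ⊕ L)) (a b : V ⊕ L) : Prop :=
  a ∉ Set.range Sum.inl ∧ G'.dir a b

/-- `a = t`, or `a` is latent and there is a directed path from `a` to `t` through latent
vertices. -/
def LatentAnc (G' : ADMG (V ⊕ L)) (a t : V ⊕ L) : Prop :=
  Relation.ReflTransGen G'.LatentDir a t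

theorem LatentAnc.reflTransGen (h : G'.LatentAnc a t) : Relation.ReflTransGen G'.dir a t :=
  Relation.ReflTransGen.mono (r := G'.LatentDir) (fun _ _ h => h.2) _ _ h

/-- A directed walk through latent vertices; by acyclicity, it is a path. -/
theorem LatentAnc.exists_path (h : G'.LatentAnc a t) :
    ∃ w, G'.IsPath a w t ∧ (∀ s ∈ w, s.1 = EdgeKind.right) ∧
      InteriorAvoids (Set.range Sum.inl) w ∧
      ∀ s ∈ w, G'.LatentAnc s.2 t ∧ Relation.TransGen G'.dir a s.2 := by
  induction h using Relation.ReflTransGen.head_induction_on with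
  | refl => exact ⟨[], ⟨rfl, by simp⟩, by simp, List.isChain_nil, by simp⟩
  | @head a a' haa' ha't ih =>
    obtain ⟨w, ⟨hw, hnd⟩, hr, hi, hs⟩ := ih
    have hanc : ∀ s ∈ (EdgeKind.right, a') :: w,
        G'.LatentAnc s.2 t ∧ Relation.TransGen G'.dir a s.2 := by
      intro s hs'
      rcases List.mem_cons.1 hs' with rfl | hs'
      · exact ⟨ha't, .single haa'.2⟩
      · exact ⟨(hs s hs').1, .head haa'.2 (hs s hs').2⟩
    refine ⟨(.right, a') :: w, ⟨⟨haa'.2, hw⟩, ?_⟩, ?_, ?_, hanc⟩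
    · refine List.nodup_cons.2 ⟨fun hmem => ?_, hnd⟩
      obtain ⟨s, hs', hsa⟩ := List.mem_map.1 hmem
      exact G'.acyclic a (by simpa [hsa] using (hanc s hs').2)
    · simpa using hr
    · rcases w with - | ⟨⟨e, c⟩, w⟩
      · exact List.isChain_singleton _
      · refine List.isChain_cons_cons.2 ⟨?_, hi⟩
        rcases Relation.ReflTransGen.cases_head ha't with rfl | ⟨x, hx, -⟩
        · exact absurd (hs _ List.mem_cons_self).2 (fun h =>
            G'.acyclic a' (Relation.TransGen.trans_left h (hs _ List.mem_cons_self).1.reflTransGen))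
        · exact hx.1

theorem LatentAnc.eq_of_inl {j : V} (h : G'.LatentAnc (Sum.inl j) t) : t = Sum.inl j := by
  rcases Relation.ReflTransGen.cases_head h with rfl | ⟨x, hx, -⟩
  · rfl
  · exact absurd ⟨j, rfl⟩ hx.1

/-- Parents in the latent projection: the observed parents of latent ancestors. -/
theorem IsMarginal.dir_of_latentAnc {G : ADMG V} (hG : G'.IsMarginal G) {v j : V}
    (hv : G'.dir (Sum.inl v) a) (ha : G'.LatentAnc a (Sum.inl j)) : G.dir v j := by
  have hvj : v ≠ j := by
    rintro rfl
    exact G'.acyclic _ (Relation.TransGen.head' hv ha.reflTransGen)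
  obtain ⟨w, ⟨hw, hnd⟩, hr, hi, hs⟩ := ha.exists_path
  have hanc : ∀ s ∈ (EdgeKind.right, a) :: w, Relation.TransGen G'.dir (Sum.inl v) s.2 := by
    intro s hs'
    rcases List.mem_cons.1 hs' with rfl | hs'
    · exact .single hv
    · exact .head hv (hs s hs').2
  refine (hG v j hvj).1.2 ⟨(.right, a) :: w, ⟨⟨hv, hw⟩, ?_⟩, by simpa using hr, ?_⟩
  · refine List.nodup_cons.2 ⟨fun hmem => ?_, hnd⟩
    obtain ⟨s, hs', hsa⟩ := List.mem_map.1 hmem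
    exact G'.acyclic (Sum.inl v) (by simpa [hsa] using hanc s hs')
  · rcases w with - | ⟨⟨e, c⟩, w⟩
    · exact List.isChain_singleton _
    · refine List.isChain_cons_cons.2 ⟨?_, hi⟩
      rcases Relation.ReflTransGen.cases_head ha with rfl | ⟨x, hx, -⟩
      · exact absurd (hs _ List.mem_cons_self) (fun h =>
          G'.acyclic _ (Relation.TransGen.trans_left h.2 h.1.reflTransGen))
      · exact hx.1

/-- A collider-free path `w₀` out of a latent ancestor `a` of `t` extends, by the reversed directed
path from `a` to `t`, to a confounding arc that starts at `t`, provided that `w₀` avoids the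
vertices of that directed path. -/
theorem LatentAnc.exists_arc {k : V ⊕ L} (h : G'.LatentAnc a t) :
    ∀ w₀ : List (EdgeKind × (V ⊕ L)), w₀ ≠ [] → G'.IsPath a w₀ k →
      w₀.IsChain (fun s t => ¬ Collider s t) →
      (∀ s ∈ w₀.getLast?, s.1.HeadAtEnd) → InteriorAvoids (Set.range Sum.inl) w₀ →
      (a = t → ∀ s ∈ w₀.head?, s.1.HeadAtStart) →
      (∀ x ∈ a :: w₀.map Prod.snd, ¬ (Relation.TransGen G'.dir a x ∧ G'.LatentAnc x t)) →
      G'.ConfoundingArcAvoiding (Set.range Sum.inl) t k := by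
  induction h using Relation.ReflTransGen.head_induction_on with
  | refl =>
    intro w₀ _ hp hc hl hi hh _
    exact ⟨w₀, hp, hc, hh rfl, hl, hi⟩
  | @head a a' haa' ha't ih =>
    intro w₀ hne hp hc hl hi _ hd
    refine ih ((.left, a) :: w₀) (by simp) ⟨⟨haa'.2, hp.1⟩, ?_⟩ ?_ ?_ ?_ ?_ ?_
    · exact List.nodup_cons.2 ⟨fun hmem => hd a' hmem ⟨.single haa'.2, ha't⟩, hp.2⟩
    · rcases w₀ with - | ⟨s, w₀⟩
      · exact absurd rfl hne
      · exact List.isChain_cons_cons.2 ⟨fun h => h.1, hc⟩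
    · rcases w₀ with - | ⟨s, w₀⟩
      · exact absurd rfl hne
      · simpa using hl
    · rcases w₀ with - | ⟨s, w₀⟩
      · exact absurd rfl hne
      · exact List.isChain_cons_cons.2 ⟨haa'.1, hi⟩
    · rintro - s hs
      obtain rfl : (EdgeKind.left, a) = s := by simpa using hs
      trivial
    · intro x hx hx'
      rcases List.mem_cons.1 hx with rfl | hx
      · exact G'.acyclic _ hx'.1
      · exact hd x hx ⟨.head haa'.2 hx'.1, hx'.2⟩

theorem isChain_not_collider_of_right {w : List (EdgeKind × (V ⊕ L))}
    (hr : ∀ s ∈ w, s.1 = EdgeKind.right) : w.IsChain (fun s t => ¬ Collider s t) := by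
  induction w with
  | nil => exact List.isChain_nil
  | cons s w ih =>
    rcases w with - | ⟨s', w⟩
    · exact List.isChain_singleton _
    · refine List.isChain_cons_cons.2 ⟨fun h => ?_, ih fun x hx => hr x (List.mem_cons_of_mem _ hx)⟩
      have := h.2
      rw [hr s' (by simp)] at this
      exact this

/-- Bidirected edges in the latent projection: vertices with a common latent ancestor, or with
latent ancestors that are joined by a bidirected edge. -/
theorem IsMarginal.bi_of_latentAnc [Finite V] [Finite L] {G : ADMG V} (hG : G'.IsMarginal G)
    {j k : V} (hjk : j ≠ k) (ha : G'.LatentAnc a (Sum.inl j)) (hb : G'.LatentAnc b (Sum.inl k))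
    (hab : G'.bi a b) : G.bi j k := by
  refine (hG j k hjk).2.2 ?_
  by_cases hcom : ∃ c, G'.LatentAnc c (Sum.inl j) ∧ G'.LatentAnc c (Sum.inl k)
  · -- A common latent ancestor without further common latent ancestors below it makes the two
    -- directed paths disjoint.
    obtain ⟨c, ⟨hcj, hck⟩, hmin⟩ := G'.wellFounded_swap_transGen_dir.has_min
      {c | G'.LatentAnc c (Sum.inl j) ∧ G'.LatentAnc c (Sum.inl k)} hcom
    obtain ⟨w, hp, hr, hi, hs⟩ := hck.exists_path
    have hne : w ≠ [] := by
      rintro rfl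
      obtain rfl : c = Sum.inl k := hp.1
      exact hjk (Sum.inl_injective hcj.eq_of_inl)
    refine hcj.exists_arc w hne hp (isChain_not_collider_of_right hr) ?_ hi ?_ ?_
    · intro s hs'
      rw [hr s (List.mem_of_mem_getLast? hs')]
      trivial
    · rintro rfl
      exact absurd (Sum.inl_injective hck.eq_of_inl).symm hjk
    · rintro x hx ⟨hcx, hxj⟩
      rcases List.mem_cons.1 hx with rfl | hx
      · exact G'.acyclic _ hcx
      · obtain ⟨s, hs', rfl⟩ := List.mem_map.1 hx
        exact hmin s.2 ⟨hxj, (hs s hs').1⟩ hcx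
  · obtain ⟨w, hp, hr, hi, hs⟩ := hb.exists_path
    have hbk : ∀ x ∈ b :: w.map Prod.snd, G'.LatentAnc x (Sum.inl k) := by
      intro x hx
      rcases List.mem_cons.1 hx with rfl | hx
      · exact hb
      · obtain ⟨s, hs', rfl⟩ := List.mem_map.1 hx
        exact (hs s hs').1
    refine ha.exists_arc ((.both, b) :: w) (by simp) ⟨⟨hab, hp.1⟩, ?_⟩ ?_ ?_ ?_ ?_ ?_
    · exact List.nodup_cons.2 ⟨fun hmem => hcom ⟨a, ha, hbk a hmem⟩, hp.2⟩
    · rcases w with - | ⟨s, w⟩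
      · exact List.isChain_singleton _
      · refine List.isChain_cons_cons.2 ⟨fun h => ?_, isChain_not_collider_of_right hr⟩
        have := h.2
        rw [hr s (by simp)] at this
        exact this
    · intro s hs'
      rcases List.mem_cons.1 (List.mem_of_mem_getLast? hs') with rfl | hs'
      · trivial
      · rw [hr s hs']
        trivial
    · rcases w with - | ⟨s, w⟩
      · exact List.isChain_singleton _
      · refine List.isChain_cons_cons.2 ⟨?_, hi⟩
        rcases Relation.ReflTransGen.cases_head hb with rfl | ⟨x, hx, -⟩
        · exact absurd (hs _ List.mem_cons_self) (fun h =>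
            G'.acyclic _ (Relation.TransGen.trans_left h.2 h.1.reflTransGen))
        · exact hx.1
    · rintro - s hs'
      obtain rfl : (EdgeKind.both, b) = s := by simpa using hs'
      trivial
    · rintro x hx ⟨hax, hxj⟩
      rcases List.mem_cons.1 hx with rfl | hx
      · exact G'.acyclic _ hax
      · exact hcom ⟨x, hxj, hbk x hx⟩

end ADMG

/-! ### Measure-theoretic preliminaries -/

/-- Random elements of a standard Borel space can be encoded in the unit interval. -/
theorem exists_unitInterval_encoding (Y : Type*) [MeasurableSpace Y] [StandardBorelSpace Y]
    [Nonempty Y] : ∃ (enc : Y → unitInterval) (dec : unitInterval → Y),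
      Measurable enc ∧ Measurable dec ∧ ∀ y, dec (enc y) = y := by
  have h := measurableEmbedding_sigmoid_comp_embeddingReal Y
  exact ⟨_, h.invFun, h.measurable, by fun_prop, h.leftInverse_invFun⟩

theorem indepFun_map_iff {Ω Ω' β γ : Type*} [MeasurableSpace Ω] [MeasurableSpace Ω']
    [MeasurableSpace β] [MeasurableSpace γ] {μ : Measure Ω} {h : Ω → Ω'} {f : Ω' → β} {g : Ω' → γ}
    (hh : Measurable h) (hf : Measurable f) (hg : Measurable g) :
    IndepFun f g (μ.map h) ↔ IndepFun (fun ω => f (h ω)) (fun ω => g (h ω)) μ := by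
  simp only [indepFun_iff_measure_inter_preimage_eq_mul]
  refine forall₄_congr fun s t hs ht => ?_
  rw [Measure.map_apply hh ((hf hs).inter (hg ht)), Measure.map_apply hh (hf hs),
    Measure.map_apply hh (hg ht)]
  rfl

theorem isProbabilityMeasure_of_map {Ω Ω' : Type*} [MeasurableSpace Ω] [MeasurableSpace Ω']
    {μ : Measure Ω} {h : Ω → Ω'} (hh : Measurable h) {ν : Measure Ω'} [IsProbabilityMeasure ν]
    (hμ : μ.map h = ν) : IsProbabilityMeasure μ := by
  refine ⟨?_⟩
  rw [← Set.preimage_univ (f := h), ← Measure.map_apply hh MeasurableSet.univ, hμ, measure_univ]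

/-! ### Joint distributions of observed variables and noise -/

/-- A pair of an observed vector and a noise vector, as one vector on `V ⊕ L`. -/
def joinNoise {V : Type u} {X : V → Type} {L : Type u} (z : (∀ v, X v) × (L → unitInterval)) :
    ∀ i, ExtSpace X L i
  | .inl v => z.1 v
  | .inr j => z.2 j

theorem measurable_joinNoise {V : Type u} {X : V → Type} [∀ v, MeasurableSpace (X v)] {L : Type u} :
    Measurable (joinNoise (X := X) (L := L)) := by
  refine measurable_pi_lambda _ ?_
  rintro (v | j)
  · exact (measurable_pi_apply v).comp measurable_fst
  · exact (measurable_pi_apply j).comp measurable_snd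

/-- The joint distribution of observed variables and noise variables. -/
noncomputable def noiseLaw {V : Type u} {X : V → Type} [∀ v, MeasurableSpace (X v)] {L : Type u}
    (ρ : Measure ((∀ v, X v) × (L → unitInterval))) [h : IsProbabilityMeasure ρ] :
    ProbabilityMeasure (∀ i, ExtSpace X L i) :=
  ⟨ρ.map joinNoise, Measure.isProbabilityMeasure_map measurable_joinNoise.aemeasurable⟩

theorem margV_noiseLaw {V : Type u} {X : V → Type} [∀ v, MeasurableSpace (X v)] {L : Type u}
    (ρ : Measure ((∀ v, X v) × (L → unitInterval))) [h : IsProbabilityMeasure ρ]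
    (P : ProbabilityMeasure (∀ v, X v)) (hP : ρ.map Prod.fst = P) : margV (noiseLaw ρ) = P := by
  refine Subtype.ext ?_
  change (ρ.map joinNoise).map (restrictObserved X L) = P
  rw [Measure.map_map (measurable_restrictObserved X L) measurable_joinNoise, ← hP]
  rfl

namespace ADMG

variable {V : Type u} {X : V → Type}

theorem measurableSet_solution [Countable V] [∀ v, MeasurableSpace (X v)]
    [∀ v, StandardBorelSpace (X v)] (G : ADMG V)
    {f : ∀ j, (∀ k : {k // G.dir k j}, X k) × unitInterval → X j} (hf : ∀ j, Measurable (f j)) :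
    MeasurableSet {z : (∀ v, X v) × (V → unitInterval) |
      ∀ j, z.1 j = f j (fun k => z.1 k, z.2 j)} := by
  rw [Set.ofPred_forall]
  exact MeasurableSet.iInter fun j =>
    measurableSet_eq_fun (by fun_prop) ((hf j).comp (by fun_prop))

/-- If the noise variables are added to a solution of a structural equation system of `G`, then the
joint distribution lies in the E model of the noise expansion. -/
theorem noiseLaw_mem_EModel [Finite V] [∀ v, MeasurableSpace (X v)]
    [∀ v, StandardBorelSpace (X v)] (G : ADMG V)
    {f : ∀ j, (∀ k : {k // G.dir k j}, X k) × unitInterval → X j}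
    {ρ : Measure ((∀ v, X v) × (V → unitInterval))} [IsProbabilityMeasure ρ]
    (hf : ∀ j, Measurable (f j)) (hM : G.NoiseMarkov (ρ.map Prod.snd))
    (hρ : ∀ᵐ z ∂ρ, ∀ j, z.1 j = f j (fun k => z.1 k, z.2 j)) :
    noiseLaw ρ ∈ G.noiseExpansion.EModel (ExtSpace X V) := by
  -- The noise vertices keep their value as noise; the noise of the original vertices is constant.
  let η : (V → unitInterval) → (V ⊕ V → unitInterval) := fun e => Sum.elim (fun _ => 0) e
  have hη : Measurable η := by
    refine measurable_pi_lambda _ ?_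
    rintro (v | j)
    · exact measurable_const
    · exact measurable_pi_apply j
  have hF : Measurable (fun z : (∀ v, X v) × (V → unitInterval) => (joinNoise z, η z.2)) :=
    measurable_joinNoise.prodMk (hη.comp measurable_snd)
  let f' : ∀ i, (∀ k : {k // G.noiseDir k i}, ExtSpace X V k) × unitInterval → ExtSpace X V i
    | .inl j => fun p => f j (fun k => p.1 ⟨.inl k, k.2⟩, p.1 ⟨.inr j, rfl⟩)
    | .inr j => fun p => p.2
  have hf' : ∀ i, Measurable (f' i) := by
    rintro (j | j)
    · refine (hf j).comp (Measurable.prodMk (measurable_pi_lambda _ fun k => ?_) ?_)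
      · exact (measurable_pi_apply (X := fun k : {k // G.noiseDir k (.inl j)} => ExtSpace X V k)
          ⟨.inl k.1, k.2⟩).comp measurable_fst
      · exact (measurable_pi_apply (X := fun k : {k // G.noiseDir k (.inl j)} => ExtSpace X V k)
          ⟨.inr j, rfl⟩).comp measurable_fst
    · exact measurable_snd
  refine ⟨f', ρ.map (fun z => (joinNoise z, η z.2)), hf', ?_, ?_, ?_⟩
  · rw [Measure.map_map measurable_fst hF]
    rfl
  · have h : (ρ.map (fun z => (joinNoise z, η z.2))).map Prod.snd = (ρ.map Prod.snd).map η := by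
      rw [Measure.map_map measurable_snd hF, Measure.map_map hη measurable_snd]
      rfl
    rw [h]
    intro J K hJK hbi
    rw [indepFun_map_iff hη (by fun_prop) (by fun_prop)]
    have h0 := hM {j | Sum.inr j ∈ J} {k | Sum.inr k ∈ K}
      (Set.disjoint_left.2 fun j hj hk => Set.disjoint_left.1 hJK hj hk)
      (fun j hj k hk => hbi (.inr j) hj (.inr k) hk)
    have key : ∀ S : Set (V ⊕ V), ∃ φ : ({j | Sum.inr j ∈ S} → unitInterval) → (S → unitInterval),
        Measurable φ ∧ ∀ e : V → unitInterval,
          (fun i : S => η e i) = φ (fun j => e j) := by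
      intro S
      refine ⟨fun y i => match i with
        | ⟨.inl _, _⟩ => 0
        | ⟨.inr j, hj⟩ => y ⟨j, hj⟩, ?_, ?_⟩
      · refine measurable_pi_lambda _ ?_
        rintro ⟨i | i, hi⟩
        · exact measurable_const
        · exact measurable_pi_apply _
      · intro e
        funext i
        rcases i with ⟨i | i, hi⟩ <;> rfl
    obtain ⟨φ, hφ, hφ'⟩ := key J
    obtain ⟨ψ, hψ, hψ'⟩ := key K
    have h1 := h0.comp hφ hψ
    simp only [Function.comp_def, ← hφ', ← hψ'] at h1
    exact h1
  · rw [ae_map_iff hF.aemeasurable (measurableSet_solution G.noiseExpansion hf')]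
    filter_upwards [hρ] with z hz
    rintro (j | j)
    · exact hz j
    · rfl

theorem EModel_subset_margV_noiseExpansion [Finite V] [∀ v, MeasurableSpace (X v)]
    [∀ v, StandardBorelSpace (X v)]
    (G : ADMG V) : G.EModel X ⊆ margV '' G.noiseExpansion.EModel (ExtSpace X V) := by
  rintro P ⟨f, ρ, hf, hP, hM, hρ⟩
  have := isProbabilityMeasure_of_map measurable_fst hP
  exact ⟨noiseLaw ρ, G.noiseLaw_mem_EModel hf hM hρ, margV_noiseLaw ρ P hP⟩

/-! ### Recursive solution of equation systems -/

section RecursiveSolution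

variable {W : Type u} [Finite W] {Y : W → Type} {A : Type*} (H : ADMG W)
  (f : ∀ i, (∀ k : {k // H.dir k i}, Y k) × A → Y i)

/-- The solution of the equations `x i = f i (x_{pa(i)}, a)`, which exists because `H` is acyclic.
-/
noncomputable def recSolution (a : A) : ∀ i, Y i :=
  H.wellFounded_dir.fix fun i ih => f i (fun k => ih k k.2, a)

theorem recSolution_eq (a : A) (i : W) :
    H.recSolution f a i = f i (fun k => H.recSolution f a k, a) := by
  rw [recSolution, WellFounded.fix_eq]

variable {f} in
theorem measurable_recSolution [∀ i, MeasurableSpace (Y i)] [MeasurableSpace A]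
    (hf : ∀ i, Measurable (f i)) : Measurable (H.recSolution f) := by
  refine measurable_pi_lambda _ fun i => ?_
  induction i using H.wellFounded_dir.induction with
  | _ i ih =>
    simp only [recSolution_eq H f _ i]
    exact (hf i).comp (Measurable.prodMk (measurable_pi_lambda _ fun k => ih k k.2) measurable_id)

end RecursiveSolution

/-! ### Elimination of latent vertices from an equation system -/

section LatentSolution

variable [Finite V] {L : Type u} [Finite L] (G' : ADMG (V ⊕ L))
  (f : ∀ i, (∀ k : {k // G'.dir k i}, ExtSpace X L k) × unitInterval → ExtSpace X L i)

/-- The values of all vertices that result from the values `x` of the observed vertices and the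
noise `e`, when the structural equations of the latent vertices are solved recursively. -/
noncomputable def latentSolution (x : ∀ v, X v) (e : V ⊕ L → unitInterval) :
    ∀ i, ExtSpace X L i :=
  G'.recSolution (A := (∀ v, X v) × (V ⊕ L → unitInterval)) (fun i p => match i, p with
    | .inl v, p => p.2.1 v
    | .inr l, p => f (.inr l) (p.1, p.2.2 (.inr l))) (x, e)

theorem latentSolution_inl (x : ∀ v, X v) (e : V ⊕ L → unitInterval) (v : V) :
    G'.latentSolution f x e (.inl v) = x v := by
  rw [latentSolution, recSolution_eq]

theorem latentSolution_inr (x : ∀ v, X v) (e : V ⊕ L → unitInterval) (l : L) :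
    G'.latentSolution f x e (.inr l) =
      f (.inr l) (fun k => G'.latentSolution f x e k, e (.inr l)) := by
  rw [latentSolution, recSolution_eq]

variable {f} in
theorem measurable_latentSolution [∀ v, MeasurableSpace (X v)] (hf : ∀ i, Measurable (f i)) :
    Measurable fun p : (∀ v, X v) × (V ⊕ L → unitInterval) => G'.latentSolution f p.1 p.2 := by
  refine G'.measurable_recSolution ?_
  rintro (v | l)
  · exact (measurable_pi_apply v).comp (measurable_fst.comp measurable_snd)
  · exact (hf _).comp (Measurable.prodMk measurable_fst
      ((measurable_pi_apply _).comp (measurable_snd.comp measurable_snd)))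

/-- The value of a latent vertex depends only on the noise of its latent ancestors and on the
observed parents of these. -/
theorem latentSolution_congr {x x' : ∀ v, X v} {e e' : V ⊕ L → unitInterval} (i : V ⊕ L)
    (hi : ∀ v, i = .inl v → x v = x' v)
    (he : ∀ a l, i = .inr l → G'.LatentAnc a i → e a = e' a)
    (hx : ∀ v a l, i = .inr l → G'.dir (.inl v) a → G'.LatentAnc a i → x v = x' v) :
    G'.latentSolution f x e i = G'.latentSolution f x' e' i := by
  induction i using G'.wellFounded_dir.induction with
  | _ i ih =>
    rcases i with v | l
    · rw [latentSolution_inl, latentSolution_inl]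
      exact hi v rfl
    · rw [latentSolution_inr, latentSolution_inr, he _ l rfl .refl]
      congr 2
      funext ⟨k, hk⟩
      have htail : ∀ a l', k = .inr l' → G'.LatentAnc a k → G'.LatentAnc a (.inr l) := by
        rintro a l' rfl ha
        exact Relation.ReflTransGen.tail ha ⟨by simp, hk⟩
      refine ih k hk ?_ ?_ ?_
      · rintro v rfl
        exact hx v _ l rfl hk .refl
      · exact fun a l' hl' ha => he a l rfl (htail a l' hl' ha)
      · exact fun v a l' hl' hv ha => hx v a l rfl hv (htail a l' hl' ha)

theorem latentSolution_eq_of_solution {x : ∀ i, ExtSpace X L i} {e : V ⊕ L → unitInterval}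
    (h : ∀ i, x i = f i (fun k => x k, e i)) (i : V ⊕ L) :
    G'.latentSolution f (restrictObserved X L x) e i = x i := by
  induction i using G'.wellFounded_dir.induction with
  | _ i ih =>
    rcases i with v | l
    · rw [latentSolution_inl]
      rfl
    · rw [latentSolution_inr, h (.inr l)]
      congr 2
      funext k
      exact ih k k.2

end LatentSolution

open Classical in
/-- The E model is closed under marginalization: the noise variable of an observed vertex of the
latent projection encodes the noise of all its latent ancestors. -/
theorem margV_mem_EModel [Finite V] [∀ v, MeasurableSpace (X v)]
    [∀ v, StandardBorelSpace (X v)] {G : ADMG V} {L : Type u} [Finite L]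
    {G' : ADMG (V ⊕ L)} (hG : G'.IsMarginal G)
    {P : ProbabilityMeasure (∀ i, ExtSpace X L i)} (hP : P ∈ G'.EModel (ExtSpace X L)) :
    margV P ∈ G.EModel X := by
  obtain ⟨f, ρ, hf, hP, hM, hρ⟩ := hP
  have hX : Nonempty (∀ v, X v) := by
    obtain ⟨x⟩ := (P : Measure (∀ i, ExtSpace X L i)).nonempty_of_neZero
    exact ⟨restrictObserved X L x⟩
  obtain ⟨d⟩ := hX
  obtain ⟨enc, dec, henc, hdec, hde⟩ := exists_unitInterval_encoding (V ⊕ L → unitInterval)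
  -- Noise variables other than those of the latent ancestors of `j` are set to `0`, observed
  -- variables other than those of the parents of `j` to a fixed value; neither matters for the
  -- equation of `j`.
  let mask : V → (V ⊕ L → unitInterval) → (V ⊕ L → unitInterval) :=
    fun j e a => if G'.LatentAnc a (.inl j) then e a else 0
  have hmask : ∀ j, Measurable (mask j) := fun j =>
    measurable_pi_lambda _ fun a => by
      by_cases h : G'.LatentAnc a (.inl j)
      · simpa only [mask, h, if_true] using measurable_pi_apply a
      · simpa only [mask, h, if_false] using measurable_const
  let η : (V ⊕ L → unitInterval) → (V → unitInterval) := fun e j => enc (mask j e)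
  have hη : Measurable η := measurable_pi_lambda _ fun j => henc.comp (hmask j)
  let ext : ∀ j, (∀ k : {k // G.dir k j}, X k) → ∀ v, X v :=
    fun j y v => if h : G.dir v j then y ⟨v, h⟩ else d v
  have hext : ∀ j, Measurable (ext j) := fun j => measurable_pi_lambda _ fun v => by
    by_cases h : G.dir v j
    · simpa only [ext, h, dif_pos] using measurable_pi_apply _
    · simpa only [ext, h, dif_neg, not_false_eq_true] using measurable_const
  let g : ∀ j, (∀ k : {k // G.dir k j}, X k) × unitInterval → X j := fun j p =>
    f (.inl j) (fun k => G'.latentSolution f (ext j p.1) (dec p.2) k, dec p.2 (.inl j))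
  have hg : ∀ j, Measurable (g j) := by
    intro j
    refine (hf (.inl j)).comp (Measurable.prodMk (measurable_pi_lambda _ fun k => ?_) ?_)
    · exact ((measurable_pi_apply (k : V ⊕ L)).comp (G'.measurable_latentSolution hf)).comp
        (((hext j).comp measurable_fst).prodMk
        (hdec.comp measurable_snd))
    · exact (measurable_pi_apply _).comp (hdec.comp measurable_snd)
  have hF : Measurable fun z : (∀ i, ExtSpace X L i) × (V ⊕ L → unitInterval) =>
      (restrictObserved X L z.1, η z.2) :=
    ((measurable_restrictObserved X L).comp measurable_fst).prodMk (hη.comp measurable_snd)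
  refine ⟨g, ρ.map fun z => (restrictObserved X L z.1, η z.2), hg, ?_, ?_, ?_⟩
  · rw [Measure.map_map measurable_fst hF]
    change _ = (P : Measure (∀ i, ExtSpace X L i)).map (restrictObserved X L)
    rw [← hP, Measure.map_map (measurable_restrictObserved X L) measurable_fst]
    rfl
  · have h : (ρ.map fun z => (restrictObserved X L z.1, η z.2)).map Prod.snd =
        (ρ.map Prod.snd).map η := by
      rw [Measure.map_map measurable_snd hF, Measure.map_map hη measurable_snd]
      rfl
    rw [h]
    intro J K hJK hbi
    rw [indepFun_map_iff hη (by fun_prop) (by fun_prop)]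
    have hbi' : ∀ j ∈ J, ∀ k ∈ K, ∀ a b, G'.LatentAnc a (.inl j) → G'.LatentAnc b (.inl k) →
        ¬ G'.bi a b := fun j hj k hk a b ha hb hab =>
      hbi j hj k hk (hG.bi_of_latentAnc
        (fun h => Set.disjoint_left.1 hJK hj (h ▸ hk)) ha hb hab)
    have h0 := hM {a | ∃ j ∈ J, G'.LatentAnc a (.inl j)} {b | ∃ k ∈ K, G'.LatentAnc b (.inl k)}
      (Set.disjoint_left.2 fun a ⟨j, hj, ha⟩ ⟨k, hk, hb⟩ =>
        hbi' j hj k hk a a ha hb (G'.bi_refl a))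
      (fun a ⟨j, hj, ha⟩ b ⟨k, hk, hb⟩ => hbi' j hj k hk a b ha hb)
    have key : ∀ S : Set V,
        ∃ φ : ({a | ∃ j ∈ S, G'.LatentAnc a (.inl j)} → unitInterval) → (S → unitInterval),
        Measurable φ ∧ ∀ e : V ⊕ L → unitInterval, (fun i : S => η e i) = φ (fun j => e j) := by
      intro S
      refine ⟨fun y j => enc fun a =>
        if h : G'.LatentAnc a (.inl j) then y ⟨a, j, j.2, h⟩ else 0, ?_, ?_⟩
      · refine measurable_pi_lambda _ fun j => henc.comp (measurable_pi_lambda _ fun a => ?_)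
        by_cases h : G'.LatentAnc a (.inl j)
        · simpa only [h, dif_pos] using measurable_pi_apply _
        · simpa only [h, dif_neg, not_false_eq_true] using measurable_const
      · intro e
        funext j
        simp only [η, mask, dite_eq_ite]
    obtain ⟨φ, hφ, hφ'⟩ := key J
    obtain ⟨ψ, hψ, hψ'⟩ := key K
    have h1 := h0.comp hφ hψ
    simp only [Function.comp_def, ← hφ', ← hψ'] at h1
    exact h1
  · rw [ae_map_iff hF.aemeasurable (measurableSet_solution G hg)]
    filter_upwards [hρ] with z hz j
    simp only [g, η, hde]
    change z.1 (.inl j) = _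
    rw [hz (.inl j)]
    have hself : mask j z.2 (.inl j) = z.2 (.inl j) := if_pos .refl
    rw [hself]
    congr 2
    funext ⟨k, hk⟩
    have hobs : ∀ v a, G'.dir (.inl v) a → G'.LatentAnc a (.inl j) →
        restrictObserved X L z.1 v = ext j (fun k => restrictObserved X L z.1 k) v := by
      intro v a hv ha
      simp only [ext]
      rw [dif_pos (hG.dir_of_latentAnc hv ha)]
    have htail : ∀ a l, k = .inr l → G'.LatentAnc a k → G'.LatentAnc a (.inl j) := by
      rintro a l rfl ha
      exact Relation.ReflTransGen.tail ha ⟨by simp, hk⟩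
    rw [← G'.latentSolution_eq_of_solution f hz k]
    refine G'.latentSolution_congr f k ?_ ?_ ?_
    · rintro v rfl
      exact hobs v _ hk .refl
    · exact fun a l hl ha => (if_pos (htail a l hl ha)).symm
    · exact fun v a l hl hv ha => hobs v a hv (htail a l hl ha)

end ADMG

/-! ### Graphoid properties of conditional independence -/

section Graphoid

variable {Ω : Type*} {m m₁ m₂ m₃ n : MeasurableSpace Ω} {mΩ : MeasurableSpace Ω}
  {μ : Measure Ω} [IsProbabilityMeasure μ]

theorem integrable_indicator_one {s : Set Ω} (hs : MeasurableSet s) :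
    Integrable (s.indicator fun _ => (1 : ℝ)) μ :=
  (integrable_const (1 : ℝ)).indicator hs

theorem indicator_eq_indicator_one_mul (s : Set Ω) (g : Ω → ℝ) :
    s.indicator g = (s.indicator fun _ => (1 : ℝ)) * g := by
  funext ω
  by_cases h : ω ∈ s <;> simp [h]

theorem condExp_indicator_condExp {s t : Set Ω} (hs : MeasurableSet s) :
    μ[s.indicator (μ⟦t | m⟧) | m] =ᵐ[μ] μ⟦s | m⟧ * μ⟦t | m⟧ := by
  rw [indicator_eq_indicator_one_mul s]
  refine condExp_mul_of_stronglyMeasurable_right stronglyMeasurable_condExp ?_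
    (integrable_indicator_one hs)
  rw [← indicator_eq_indicator_one_mul]
  exact integrable_condExp.indicator hs

variable [StandardBorelSpace Ω]

/-- The conditioning variable may be added to one of two conditionally independent variables. -/
theorem ProbabilityTheory.CondIndep.sup_cond {hm : m ≤ mΩ} (h₁ : m₁ ≤ mΩ) (h₂ : m₂ ≤ mΩ)
    (h : CondIndep m m₁ m₂ hm μ) : CondIndep m (m₁ ⊔ m) m₂ hm μ := by
  let p : Set (Set Ω) := {u | ∃ s c, MeasurableSet[m₁] s ∧ MeasurableSet[m] c ∧ u = c ∩ s}
  have hp : IsPiSystem p := by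
    rintro _ ⟨s, c, hs, hc, rfl⟩ _ ⟨s', c', hs', hc', rfl⟩ -
    exact ⟨s ∩ s', c ∩ c', hs.inter hs', hc.inter hc', Set.inter_inter_inter_comm _ _ _ _⟩
  have hgen : m₁ ⊔ m = MeasurableSpace.generateFrom p := by
    apply le_antisymm
    · refine sup_le (fun s hs => ?_) (fun c hc => ?_)
      · exact MeasurableSpace.measurableSet_generateFrom
          ⟨s, Set.univ, hs, MeasurableSet.univ, (Set.univ_inter s).symm⟩
      · exact MeasurableSpace.measurableSet_generateFrom
          ⟨Set.univ, c, MeasurableSet.univ, hc, (Set.inter_univ c).symm⟩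
    · refine MeasurableSpace.generateFrom_le ?_
      rintro _ ⟨s, c, hs, hc, rfl⟩
      exact MeasurableSet.inter ((le_sup_right : m ≤ m₁ ⊔ m) c hc)
        ((le_sup_left : m₁ ≤ m₁ ⊔ m) s hs)
  refine CondIndepSets.condIndep (p1 := p) (p2 := {t | MeasurableSet[m₂] t}) (sup_le h₁ hm) h₂ hp
    (@MeasurableSpace.isPiSystem_measurableSet Ω m₂) hgen
    (@MeasurableSpace.generateFrom_measurableSet Ω m₂).symm ?_
  rw [condIndepSets_iff _ _ _ _ _ _ μ]
  · rintro _ t ⟨s, c, hs, hc, rfl⟩ ht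
    have h0 := (condIndep_iff m m₁ m₂ hm h₁ h₂ μ).1 h s t hs ht
    have e1 : ((c ∩ s) ∩ t).indicator (fun _ => (1 : ℝ)) =
        c.indicator ((s ∩ t).indicator fun _ => (1 : ℝ)) := by
      rw [Set.indicator_indicator, Set.inter_assoc]
    have e2 : (c ∩ s).indicator (fun _ => (1 : ℝ)) =
        c.indicator (s.indicator fun _ => (1 : ℝ)) := by
      rw [Set.indicator_indicator]
    rw [e1, e2]
    have i1 := condExp_indicator (μ := μ) (m := m)
      (integrable_indicator_one (μ := μ) ((h₁ s hs).inter (h₂ t ht))) hc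
    have i2 := condExp_indicator (μ := μ) (m := m) (integrable_indicator_one (μ := μ) (h₁ s hs)) hc
    filter_upwards [h0, i1, i2] with ω h0 i1 i2
    rw [i1, Pi.mul_apply, i2]
    by_cases hω : ω ∈ c
    · simpa [hω] using h0
    · simp [hω]
  · rintro _ ⟨s, c, hs, hc, rfl⟩
    exact (hm c hc).inter (h₁ s hs)
  · exact fun t ht => h₂ t ht

theorem ProbabilityTheory.CondIndep.condExp_eq {hm : m ≤ mΩ} (h₁ : m₁ ≤ mΩ) (h₂ : m₂ ≤ mΩ)
    (h : CondIndep m m₁ m₂ hm μ) {t : Set Ω} (ht : MeasurableSet[m₂] t) :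
    μ⟦t | m₁ ⊔ m⟧ =ᵐ[μ] μ⟦t | m⟧ := by
  have hn : m₁ ⊔ m ≤ mΩ := sup_le h₁ hm
  have ht' := h₂ t ht
  have hsm : StronglyMeasurable[m₁ ⊔ m] (μ⟦t | m⟧) := stronglyMeasurable_condExp.mono le_sup_right
  symm
  refine ae_eq_condExp_of_forall_setIntegral_eq hn (integrable_indicator_one ht')
    (fun _ _ _ => integrable_condExp.integrableOn) (fun u hu _ => ?_)
    hsm.aestronglyMeasurable
  have hu' := hn u hu
  have h0 := (condIndep_iff m (m₁ ⊔ m) m₂ hm hn h₂ μ).1 (CondIndep.sup_cond h₁ h₂ h) u t hu ht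
  calc ∫ ω in u, (μ⟦t | m⟧) ω ∂μ = ∫ ω, u.indicator (μ⟦t | m⟧) ω ∂μ := (integral_indicator hu').symm
    _ = ∫ ω, (μ[u.indicator (μ⟦t | m⟧) | m]) ω ∂μ := (integral_condExp hm).symm
    _ = ∫ ω, (μ⟦u ∩ t | m⟧) ω ∂μ :=
        integral_congr_ae ((condExp_indicator_condExp hu').trans h0.symm)
    _ = ∫ ω, (u ∩ t).indicator (fun _ => (1 : ℝ)) ω ∂μ := integral_condExp hm
    _ = ∫ ω in u, t.indicator (fun _ => (1 : ℝ)) ω ∂μ := by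
        rw [← Set.indicator_indicator, integral_indicator hu']

theorem condIndep_of_condExp_eq (hm : m ≤ mΩ) (h₂ : m₂ ≤ mΩ) (hn : n ≤ mΩ)
    (hmn : m ≤ n) (h₁n : m₁ ≤ n)
    (h : ∀ t, MeasurableSet[m₂] t → μ⟦t | n⟧ =ᵐ[μ] μ⟦t | m⟧) : CondIndep m m₁ m₂ hm μ := by
  rw [condIndep_iff m m₁ m₂ hm (h₁n.trans hn) h₂]
  intro s t hs ht
  have hs' := hn s (h₁n s hs)
  rw [← Set.indicator_indicator]
  have i1 := condExp_indicator (μ := μ) (m := n)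
    (integrable_indicator_one (μ := μ) (h₂ t ht)) (h₁n s hs)
  have i2 : s.indicator (μ⟦t | n⟧) =ᵐ[μ] s.indicator (μ⟦t | m⟧) := by
    filter_upwards [h t ht] with ω hω
    by_cases hs : ω ∈ s <;> simp [hs, hω]
  exact (condExp_condExp_of_le hmn hn).symm.trans
    ((condExp_congr_ae (i1.trans i2)).trans (condExp_indicator_condExp hs'))

theorem ProbabilityTheory.CondIndep.weak_union {hm : m ≤ mΩ}
    (h₁ : m₁ ≤ mΩ) (h₂ : m₂ ≤ mΩ) (h₃ : m₃ ≤ mΩ)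
    (h : CondIndep m (m₁ ⊔ m₃) m₂ hm μ) : CondIndep (m ⊔ m₃) m₁ m₂ (sup_le hm h₃) μ := by
  refine condIndep_of_condExp_eq (sup_le hm h₃) h₂ (sup_le (sup_le h₁ h₃) hm)
    (sup_le le_sup_right (le_sup_right.trans le_sup_left)) (le_sup_left.trans le_sup_left)
    fun t ht => ?_
  have h' := CondIndep.condExp_eq h₃ h₂ (condIndep_of_condIndep_of_le_left h le_sup_right) ht
  rw [sup_comm] at h'
  exact (CondIndep.condExp_eq (sup_le h₁ h₃) h₂ h ht).trans h'.symm

theorem condIndep_bot_of_indep (h₁ : m₁ ≤ mΩ) (h₂ : m₂ ≤ mΩ) (h : Indep m₁ m₂ μ) :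
    CondIndep ⊥ m₁ m₂ bot_le μ := by
  rw [condIndep_iff ⊥ m₁ m₂ bot_le h₁ h₂]
  intro s t hs ht
  refine Filter.EventuallyEq.of_eq ?_
  rw [condExp_bot, condExp_bot, condExp_bot]
  funext ω
  have h0 := (Indep_iff m₁ m₂ μ).1 h s t hs ht
  simp only [Pi.mul_apply]
  rw [integral_indicator_const _ (h₁ s hs), integral_indicator_const _ (h₂ t ht),
    integral_indicator_const _ ((h₁ s hs).inter (h₂ t ht))]
  simp [measureReal_def, h0, ENNReal.toReal_mul]

theorem indep_of_condIndep_bot (h₁ : m₁ ≤ mΩ) (h₂ : m₂ ≤ mΩ) (h : CondIndep ⊥ m₁ m₂ bot_le μ) :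
    Indep m₁ m₂ μ := by
  rw [Indep_iff]
  intro s t hs ht
  obtain ⟨ω, h0⟩ := ((condIndep_iff ⊥ m₁ m₂ bot_le h₁ h₂ μ).1 h s t hs ht).exists
  rw [condExp_bot, condExp_bot, condExp_bot] at h0
  simp only [Pi.mul_apply] at h0
  rw [integral_indicator_const _ (h₁ s hs), integral_indicator_const _ (h₂ t ht),
    integral_indicator_const _ ((h₁ s hs).inter (h₂ t ht))] at h0
  simp only [smul_eq_mul, mul_one, measureReal_def] at h0
  rw [← ENNReal.toReal_mul] at h0
  exact (ENNReal.toReal_eq_toReal_iff' (measure_ne_top _ _)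
    (ENNReal.mul_ne_top (measure_ne_top _ _) (measure_ne_top _ _))).1 h0

/-- Conditional independence is inherited by σ-algebras that coincide up to null sets. -/
theorem ProbabilityTheory.CondIndep.of_ae_eq_left {hm : m ≤ mΩ}
    (h₁ : m₁ ≤ mΩ) (h₂ : m₂ ≤ mΩ) (h₃ : m₃ ≤ mΩ)
    (h : CondIndep m m₁ m₂ hm μ)
    (h' : ∀ s, MeasurableSet[m₃] s → ∃ s', MeasurableSet[m₁] s' ∧ s =ᵐ[μ] s') :
    CondIndep m m₃ m₂ hm μ := by
  rw [condIndep_iff m m₃ m₂ hm h₃ h₂]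
  intro s t hs ht
  obtain ⟨s', hs', hss'⟩ := h' s hs
  have e1 : (s ∩ t).indicator (fun _ => (1 : ℝ)) =ᵐ[μ] (s' ∩ t).indicator (fun _ => (1 : ℝ)) :=
    indicator_ae_eq_of_ae_eq_set (hss'.inter (Filter.EventuallyEq.refl _ t))
  have e2 : s.indicator (fun _ => (1 : ℝ)) =ᵐ[μ] s'.indicator (fun _ => (1 : ℝ)) :=
    indicator_ae_eq_of_ae_eq_set hss'
  exact (condExp_congr_ae e1).trans (((condIndep_iff m m₁ m₂ hm h₁ h₂ μ).1 h s' t hs' ht).trans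
    ((condExp_congr_ae e2).symm.mul (Filter.EventuallyEq.refl _ _)))

end Graphoid

/-! ### Open walks within a set of vertices -/

/-- The edge kind of an edge that is traversed in the opposite direction. -/
def EdgeKind.reverse : EdgeKind → EdgeKind
  | .right => .left
  | .left => .right
  | .both => .both

theorem EdgeKind.headAtStart_reverse (e : EdgeKind) : e.reverse.HeadAtStart ↔ e.HeadAtEnd := by
  cases e <;> exact Iff.rfl

theorem EdgeKind.headAtEnd_reverse (e : EdgeKind) : e.reverse.HeadAtEnd ↔ e.HeadAtStart := by
  cases e <;> exact Iff.rfl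

namespace ADMG

section OpenWalk

variable {W : Type u} {G : ADMG W} {T T' L : Set W} {a b c : W} {e e' e₁ e₂ e₃ e₄ : EdgeKind}

theorem HasEdge.reverse (h : G.HasEdge e a b) : G.HasEdge e.reverse b a := by
  cases e
  · exact h
  · exact h
  · exact G.bi_symm _ _ h

/-- A walk that enters `c` through an edge of kind `e` and leaves it through one of kind `e'` is not
blocked by `L` at `c`. -/
def Passable (L : Set W) (e : EdgeKind) (c : W) (e' : EdgeKind) : Prop :=
  (e.HeadAtEnd ∧ e'.HeadAtStart → c ∈ L) ∧ (¬ (e.HeadAtEnd ∧ e'.HeadAtStart) → c ∉ L)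

theorem Passable.reverse (h : Passable L e c e') : Passable L e'.reverse c e.reverse := by
  simpa only [Passable, EdgeKind.headAtStart_reverse, EdgeKind.headAtEnd_reverse, and_comm] using h

/-- `G.OpenWalk T L a e₁ e₂ b`: some walk of `G` with at least one edge leads from `a` to `b`,
stays within `T`, is not blocked by `L`, and has a first edge of kind `e₁` and a last edge of kind
`e₂`. -/
inductive OpenWalk (G : ADMG W) (T L : Set W) : W → EdgeKind → EdgeKind → W → Prop
  | single {e : EdgeKind} {a b : W} : G.HasEdge e a b → a ∈ T → b ∈ T → OpenWalk G T L a e e b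
  | cons {e e₁ e₂ : EdgeKind} {a c b : W} : G.HasEdge e a c → a ∈ T → Passable L e c e₁ →
      OpenWalk G T L c e₁ e₂ b → OpenWalk G T L a e e₂ b

namespace OpenWalk

theorem mono (hT : T' ⊆ T) (h : G.OpenWalk T' L a e₁ e₂ b) : G.OpenWalk T L a e₁ e₂ b := by
  induction h with
  | single he ha hb => exact single he (hT ha) (hT hb)
  | cons he ha hp _ ih => exact cons he (hT ha) hp ih

theorem exists_first (h : G.OpenWalk T L a e₁ e₂ b) : a ∈ T ∧ ∃ c ∈ T, G.HasEdge e₁ a c := by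
  induction h with
  | single he ha hb => exact ⟨ha, _, hb, he⟩
  | cons he ha hp _ ih => exact ⟨ha, _, ih.1, he⟩

theorem exists_last (h : G.OpenWalk T L a e₁ e₂ b) : ∃ c ∈ T, G.HasEdge e₂ c b := by
  induction h with
  | single he ha hb => exact ⟨_, ha, he⟩
  | cons he ha hp _ ih => exact ih

theorem append (h : G.OpenWalk T L a e₁ e₂ c) (hp : Passable L e₂ c e₃)
    (h' : G.OpenWalk T L c e₃ e₄ b) : G.OpenWalk T L a e₁ e₄ b := by
  induction h with
  | single he ha hb => exact cons he ha hp h'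
  | cons he ha hp' _ ih => exact cons he ha hp' (ih hp h')

theorem reverse (h : G.OpenWalk T L a e₁ e₂ b) :
    G.OpenWalk T L b e₂.reverse e₁.reverse a := by
  induction h with
  | single he ha hb => exact single he.reverse hb ha
  | cons he ha hp h ih => exact ih.append hp.reverse (single he.reverse h.exists_first.1 ha)

/-- A sink is a collider wherever a walk passes through it, so that an open walk does not pass
through it unless it is in the conditioning set. -/
theorem insert_sink {v : W} (hv : ∀ w ∈ T, ¬ G.dir v w) (hvL : v ∉ L)
    (h : G.OpenWalk T L a e₁ e₂ b) : G.OpenWalk T (insert v L) a e₁ e₂ b := by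
  induction h with
  | single he ha hb => exact single he ha hb
  | @cons e e₁ e₂ a c b he ha hp h ih =>
    refine cons he ha ?_ ih
    have hcv : c ≠ v := by
      rintro rfl
      refine hvL (hp.1 ⟨?_, ?_⟩)
      · cases e
        · trivial
        · exact hv a ha he
        · trivial
      · obtain ⟨-, x, hx, hcx⟩ := h.exists_first
        cases e₁
        · exact hv x hx hcx
        · trivial
        · trivial
    simpa only [Passable, Set.mem_insert_iff, hcv, false_or] using hp

/-- Open walks in the whole graph witness m-connection. -/
theorem exists_isWalk (h : G.OpenWalk Set.univ L a e₁ e₂ b) :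
    ∃ c w, G.IsWalk a ((e₁, c) :: w) b ∧
      ((e₁, c) :: w).IsChain (fun s t =>
        (Collider s t → s.2 ∈ L) ∧ (¬ Collider s t → s.2 ∉ L)) := by
  induction h with
  | single he ha hb => exact ⟨_, [], ⟨he, rfl⟩, List.isChain_singleton _⟩
  | cons he ha hp _ ih =>
    obtain ⟨c, w, hw, hc⟩ := ih
    exact ⟨_, _, ⟨he, hw⟩, List.isChain_cons_cons.2 ⟨hp, hc⟩⟩

end OpenWalk

/-- `J` and `K` are m-separated by `L` within the vertex set `T`. -/
def Separated (G : ADMG W) (T J K L : Set W) : Prop :=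
  ∀ j ∈ J, ∀ k ∈ K, ∀ e₁ e₂, ¬ G.OpenWalk T L j e₁ e₂ k

theorem Separated.symm {J K : Set W} (h : G.Separated T J K L) : G.Separated T K J L :=
  fun k hk j hj _ _ hw => h j hj k hk _ _ hw.reverse

theorem separated_of_not_mConnected {J K : Set W} (h : ¬ G.MConnected J K L) :
    G.Separated Set.univ J K L := fun j hj k hk _ _ hw => by
  obtain ⟨c, w, hw, hc⟩ := hw.exists_isWalk
  exact h ⟨j, hj, k, hk, _, hw, hc⟩

end OpenWalk

end ADMG

/-! ### The global Markov property of structural equation systems -/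

section CoordSigma

variable {W : Type u} {Y : W → Type} [mY : ∀ i, MeasurableSpace (Y i)]

/-- The σ-algebra that is generated by the coordinates in `S`. -/
abbrev coordSigma (Y : W → Type) [∀ i, MeasurableSpace (Y i)] (S : Set W) :
    MeasurableSpace (∀ i, Y i) :=
  MeasurableSpace.comap (fun (x : ∀ i, Y i) (i : S) => x i) inferInstance

theorem coordSigma_le (S : Set W) : coordSigma Y S ≤ MeasurableSpace.pi :=
  Measurable.comap_le (by fun_prop)

theorem coordSigma_eq_iSup (S : Set W) :
    coordSigma Y S = ⨆ i ∈ S, (mY i).comap (fun x => x i) := by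
  simp only [coordSigma, MeasurableSpace.pi, MeasurableSpace.comap_iSup,
    MeasurableSpace.comap_comp, iSup_subtype']
  rfl

theorem coordSigma_union (S T : Set W) :
    coordSigma Y (S ∪ T) = coordSigma Y S ⊔ coordSigma Y T := by
  simp only [coordSigma_eq_iSup, iSup_union]

theorem measurable_coordSigma {S : Set W} {i : W} (hi : i ∈ S) :
    Measurable[coordSigma Y S] fun x : ∀ i, Y i => x i :=
  (measurable_pi_apply (X := fun i : S => Y i) ⟨i, hi⟩).comp (comap_measurable _)

end CoordSigma

section GlobalMarkov

variable {W : Type u} [Finite W] {Y : W → Type} [mY : ∀ i, MeasurableSpace (Y i)]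
  [∀ i, StandardBorelSpace (Y i)] (P : Measure (∀ i, Y i)) [IsProbabilityMeasure P]

/-- The subvectors with coordinates in `J` and in `K` are conditionally independent given that with
coordinates in `L`. -/
def CoordCondIndep (J K L : Set W) : Prop :=
  CondIndep (coordSigma Y L) (coordSigma Y J) (coordSigma Y K) (coordSigma_le L) P

namespace CoordCondIndep

variable {P} {J K L M : Set W}

theorem symm (h : CoordCondIndep P J K L) : CoordCondIndep P K J L := CondIndep.symm h

theorem weak_union (h : CoordCondIndep P (J ∪ M) K L) : CoordCondIndep P J K (L ∪ M) := by
  unfold CoordCondIndep at h ⊢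
  rw [coordSigma_union] at h
  have h' := CondIndep.weak_union (coordSigma_le J) (coordSigma_le K) (coordSigma_le M) h
  convert h' using 1
  exact coordSigma_union L M

/-- A variable that is almost surely a function of other variables may be added to these. -/
theorem of_determined {v : W} {J' pa : Set W} (h : CoordCondIndep P J' K L)
    (hJ : J ⊆ insert v J') (hpa : pa ⊆ J' ∪ L) {ψ : (∀ k : pa, Y k) → Y v} (hψ : Measurable ψ)
    (hv : ∀ᵐ x ∂P, x v = ψ (fun k => x k)) : CoordCondIndep P J K L := by
  classical
  have h' := CondIndep.sup_cond (coordSigma_le J') (coordSigma_le K) h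
  rw [← coordSigma_union] at h'
  refine CondIndep.of_ae_eq_left (coordSigma_le _) (coordSigma_le K) (coordSigma_le J) h' ?_
  -- The coordinate `v` is replaced by the function of the other variables that determines it.
  let r : (∀ i, Y i) → ∀ i, Y i := fun x => Function.update x v (ψ fun k => x k)
  have hr : ∀ᵐ x ∂P, r x = x := by
    filter_upwards [hv] with x hx
    simp only [r, ← hx, Function.update_eq_self]
  have hrm : Measurable[coordSigma Y (J' ∪ L)] fun x (i : J) => r x i := by
    refine @measurable_pi_lambda _ _ _ (coordSigma Y (J' ∪ L)) _ _ fun i => ?_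
    by_cases hi : (i : W) = v
    · obtain ⟨i, hiJ⟩ := i
      obtain rfl : i = v := hi
      simp only [r, Function.update_self]
      exact hψ.comp (@measurable_pi_lambda _ _ _ (coordSigma Y (J' ∪ L)) _ _
        fun k => measurable_coordSigma (hpa k.2))
    · simp only [r, Function.update_of_ne hi]
      exact measurable_coordSigma (Or.inl ((hJ i.2).resolve_left hi))
  rintro _ ⟨A, hA, rfl⟩
  refine ⟨_, hrm hA, ?_⟩
  filter_upwards [hr] with x hx
  refine propext ?_
  change (fun i : J => x i) ∈ A ↔ (fun i : J => r x i) ∈ A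
  rw [hx]

end CoordCondIndep

namespace ADMG

variable {P} {G : ADMG W} {T J K L E : Set W}

/-- The inductive step of the global Markov property: a sink `v` that is determined by its parents
and does not belong to `K ∪ L` is replaced by its parents. -/
theorem coordCondIndep_of_sink {v : W} (hv : v ∈ T)
    (hpaT : ∀ w, G.dir w v → w ∈ T)
    (IH : ∀ J K L : Set W, J ⊆ T \ {v} → K ⊆ T \ {v} → L ⊆ T \ {v} → Disjoint J K → Disjoint J L →
      Disjoint K L → G.Separated (T \ {v}) J K L → CoordCondIndep P J K L)
    {ψ : (∀ k : {k | G.dir k v}, Y k) → Y v} (hψ : Measurable ψ)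
    (hdet : ∀ᵐ x ∂P, x v = ψ (fun k => x k))
    (hJ : J ⊆ T) (hK : K ⊆ T) (hL : L ⊆ T) (hJK : Disjoint J K) (hJL : Disjoint J L)
    (hKL : Disjoint K L) (hvK : v ∉ K) (hvL : v ∉ L) (hsep : G.Separated T J K L) :
    CoordCondIndep P J K L := by
  have hK' : K ⊆ T \ {v} := fun k hk => ⟨hK hk, fun h => hvK (h ▸ hk)⟩
  have hL' : L ⊆ T \ {v} := fun k hk => ⟨hL hk, fun h => hvL (h ▸ hk)⟩
  by_cases hvJ : v ∈ J
  · have h := IH ((J \ {v}) ∪ ({p | G.dir p v} \ L)) K L ?_ hK' hL' ?_ ?_ hKL ?_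
    · refine h.of_determined (v := v) (fun j hj => ?_) (fun p hp => ?_) hψ hdet
      · by_cases hjv : j = v
        · exact Or.inl hjv
        · exact Or.inr (Or.inl ⟨hj, hjv⟩)
      · by_cases hpL : p ∈ L
        · exact Or.inr hpL
        · exact Or.inl (Or.inr ⟨hp, hpL⟩)
    · rintro j (⟨hj, hjv⟩ | ⟨hp, -⟩)
      · exact ⟨hJ hj, hjv⟩
      · refine ⟨hpaT j hp, ?_⟩
        rintro rfl
        exact G.acyclic _ (.single hp)
    · refine Set.disjoint_left.2 ?_
      rintro j (⟨hj, -⟩ | ⟨hp, -⟩) hjK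
      · exact Set.disjoint_left.1 hJK hj hjK
      · exact hsep v hvJ j hjK .left .left (.single hp hv (hK hjK))
    · refine Set.disjoint_left.2 ?_
      rintro j (⟨hj, -⟩ | ⟨-, hp⟩) hjL
      · exact Set.disjoint_left.1 hJL hj hjL
      · exact hp hjL
    · rintro j (⟨hj, -⟩ | ⟨hp, hpL⟩) k hk e₁ e₂ hw
      · exact hsep j hj k hk _ _ (hw.mono Set.sdiff_subset)
      · exact hsep v hvJ k hk .left _ (.cons (c := j) hp hv ⟨fun h => h.1.elim, fun _ => hpL⟩
          (hw.mono Set.sdiff_subset))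
  · exact IH J K L (fun j hj => ⟨hJ hj, fun h => hvJ (h ▸ hj)⟩) hK' hL' hJK hJL hKL
      fun j hj k hk _ _ hw => hsep j hj k hk _ _ (hw.mono Set.sdiff_subset)

/-- Among exogenous variables, the unconditional Markov property implies the global one: `L` is
split into the vertices that are reached from `J` and the others. -/
theorem coordCondIndep_of_exogenous (hE : ∀ w ∈ E, G.Exogenous w)
    (hM : ∀ J K : Set W, J ⊆ E → K ⊆ E → Disjoint J K → (∀ j ∈ J, ∀ k ∈ K, ¬ G.bi j k) →
      Indep (coordSigma Y J) (coordSigma Y K) P)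
    (hJ : J ⊆ E) (hK : K ⊆ E) (hL : L ⊆ E) (hJK : Disjoint J K) (hJL : Disjoint J L)
    (hKL : Disjoint K L) (hsep : G.Separated E J K L) : CoordCondIndep P J K L := by
  have hboth : ∀ {e a b}, a ∈ E → b ∈ E → G.HasEdge e a b → e = .both := by
    intro e a b ha hb he
    cases e
    · exact (hE b hb a he).elim
    · exact (hE a ha b he).elim
    · rfl
  let M : Set W := {l ∈ L | ∃ j ∈ J, ∃ e₁ e₂, G.OpenWalk E L j e₁ e₂ l}
  have hML : M ⊆ L := Set.sep_subset _ _
  have hext : ∀ a ∈ M, ∀ b ∈ E, G.bi a b → ∃ j ∈ J, ∃ e₁ e₂, G.OpenWalk E L j e₁ e₂ b := by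
    rintro a ⟨haL, j, hj, e₁, e₂, hw⟩ b hb hab
    obtain ⟨c, hc, hca⟩ := hw.exists_last
    obtain rfl := hboth hc (hL haL) hca
    exact ⟨j, hj, e₁, .both, hw.append (e₃ := .both)
      ⟨fun _ => haL, fun h => (h ⟨trivial, trivial⟩).elim⟩
      (.single hab (hL haL) hb)⟩
  have hind : Indep (coordSigma Y (J ∪ M)) (coordSigma Y (K ∪ (L \ M))) P := by
    refine hM _ _ (Set.union_subset hJ (hML.trans hL))
      (Set.union_subset hK (Set.sdiff_subset.trans hL)) ?_ ?_
    · rw [Set.disjoint_union_left, Set.disjoint_union_right, Set.disjoint_union_right]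
      exact ⟨⟨hJK, hJL.mono_right Set.sdiff_subset⟩, (hKL.mono_right hML).symm,
        Set.disjoint_sdiff_right⟩
    · rintro a (ha | ha) b (hb | hb) hab
      · exact hsep a ha b hb _ _ (.single (e := .both) hab (hJ ha) (hK hb))
      · exact hb.2 ⟨hb.1, a, ha, _, _, .single (e := .both) hab (hJ ha) (hL hb.1)⟩
      · obtain ⟨j, hj, e₁, e₂, hw⟩ := hext a ha b (hK hb) hab
        exact hsep j hj b hb _ _ hw
      · exact hb.2 ⟨hb.1, hext a ha b (hL hb.1) hab⟩
  have h0 : CoordCondIndep P (J ∪ M) (K ∪ (L \ M)) ∅ := by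
    have := condIndep_bot_of_indep (coordSigma_le _) (coordSigma_le _) hind
    unfold CoordCondIndep
    convert this using 1
    simp [coordSigma_eq_iSup]
  have h1 := h0.weak_union.symm.weak_union.symm
  rwa [Set.empty_union, Set.union_sdiff_cancel hML] at h1

/-- The global Markov property of a structural equation system: the variables in `E` are exogenous
and satisfy the unconditional Markov property with respect to the bidirected edges, and every
other variable is a function of its parents. The proof removes sinks from an ancestral set `T`. -/
theorem coordCondIndep_of_determined (hE : ∀ w ∈ E, G.Exogenous w)
    (hM : ∀ J K : Set W, J ⊆ E → K ⊆ E → Disjoint J K → (∀ j ∈ J, ∀ k ∈ K, ¬ G.bi j k) →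
      Indep (coordSigma Y J) (coordSigma Y K) P)
    (hdet : ∀ v ∉ E, ∃ ψ : (∀ k : {k | G.dir k v}, Y k) → Y v, Measurable ψ ∧
      ∀ᵐ x ∂P, x v = ψ (fun k => x k))
    (n : ℕ) : ∀ T : Set W, E ⊆ T → (∀ w ∈ T, ∀ p, G.dir p w → p ∈ T) → (T \ E).ncard = n →
      ∀ J K L : Set W, J ⊆ T → K ⊆ T → L ⊆ T → Disjoint J K → Disjoint J L → Disjoint K L →
      G.Separated T J K L → CoordCondIndep P J K L := by
  induction n with
  | zero =>
    intro T hET _ hn J K L hJ hK hL hJK hJL hKL hsep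
    obtain rfl : T = E :=
      (Set.sdiff_eq_empty.1 ((Set.ncard_eq_zero (Set.toFinite _)).1 hn)).antisymm hET
    exact coordCondIndep_of_exogenous hE hM hJ hK hL hJK hJL hKL hsep
  | succ n ihn =>
    intro T hET hT hn J K L hJ hK hL hJK hJL hKL hsep
    obtain ⟨v, ⟨hvT, hvE⟩, hmax⟩ := G.wellFounded_swap_transGen_dir.has_min (T \ E)
      ((Set.ncard_pos (Set.toFinite _)).1 (by omega))
    have hsink : ∀ w ∈ T, ¬ G.dir v w := fun w hw h =>
      hmax w ⟨hw, fun hwE => hE w hwE v h⟩ (.single h)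
    have IH := ihn (T \ {v}) (fun w hw => ⟨hET hw, fun h => hvE (h ▸ hw)⟩)
      (fun w hw p hp => ⟨hT w hw.1 p hp, fun h => hsink w hw.1 (h ▸ hp)⟩) (by
        have : (T \ {v}) \ E = (T \ E) \ {v} := Set.sdiff_sdiff_comm
        rw [this, Set.ncard_sdiff_singleton_of_mem (show v ∈ T \ E from ⟨hvT, hvE⟩), hn,
          Nat.add_sub_cancel])
    obtain ⟨ψ, hψ, hψv⟩ := hdet v hvE
    have step : ∀ {J K L : Set W}, J ⊆ T → K ⊆ T → L ⊆ T → Disjoint J K → Disjoint J L →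
        Disjoint K L → v ∉ K → v ∉ L → G.Separated T J K L → CoordCondIndep P J K L :=
      coordCondIndep_of_sink hvT (hT v hvT) IH hψ hψv
    by_cases hvL : v ∈ L
    · have hvJ : v ∉ J := fun h => Set.disjoint_left.1 hJL h hvL
      have hvK : v ∉ K := fun h => Set.disjoint_left.1 hKL h hvL
      have hvL' : v ∉ L \ {v} := fun h => h.2 rfl
      have hLv : (L \ {v}) ∪ {v} = L := Set.sdiff_union_of_subset (Set.singleton_subset_iff.2 hvL)
      have hLi : insert v (L \ {v}) = L := by
        rw [Set.insert_sdiff_singleton, Set.insert_eq_of_mem hvL]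
      have hins : ∀ {a e₁ e₂ b}, G.OpenWalk T (L \ {v}) a e₁ e₂ b → G.OpenWalk T L a e₁ e₂ b := by
        intro a e₁ e₂ b hw
        have := hw.insert_sink hsink hvL'
        rwa [hLi] at this
      -- Without `v` in the conditioning set, one of the two sides is separated from `v` and may
      -- absorb it: otherwise an open walk through the collider `v` would connect `J` and `K`.
      have main : ∀ {J K : Set W}, J ⊆ T → K ⊆ T → Disjoint J K → Disjoint J L → Disjoint K L →
          v ∉ K → G.Separated T J K L → G.Separated T {v} K (L \ {v}) →
          CoordCondIndep P J K L := by
        intro J K hJ hK hJK hJL hKL hvK hsep hsepv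
        have h : CoordCondIndep P (J ∪ {v}) K (L \ {v}) := by
          refine step (Set.union_subset hJ (Set.singleton_subset_iff.2 hvT)) hK
            (Set.sdiff_subset.trans hL) ?_ ?_ (hKL.mono_right Set.sdiff_subset) hvK hvL' ?_
          · exact Set.disjoint_union_left.2 ⟨hJK, Set.disjoint_singleton_left.2 hvK⟩
          · exact Set.disjoint_union_left.2
              ⟨hJL.mono_right Set.sdiff_subset, Set.disjoint_singleton_left.2 hvL'⟩
          · rintro j (hj | hj) k hk _ _ hw
            · exact hsep j hj k hk _ _ (hins hw)
            · exact hsepv j hj k hk _ _ hw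
        have h' := h.weak_union
        rwa [hLv] at h'
      by_cases hsK : G.Separated T {v} K (L \ {v})
      · exact main hJ hK hJK hJL hKL hvK hsep hsK
      · refine (main hK hJ hJK.symm hKL hJL hvJ hsep.symm ?_).symm
        rintro _ rfl j hj e₁ e₂ hw
        refine hsK ?_
        rintro _ rfl k hk e₃ e₄ hw'
        refine hsep j hj k hk _ _ ((hins hw.reverse).append ⟨fun _ => hvL, fun h => ?_⟩ (hins hw'))
        obtain ⟨-, c, hc, he⟩ := hw.exists_first
        obtain ⟨-, c', hc', he'⟩ := hw'.exists_first
        refine (h ⟨(EdgeKind.headAtEnd_reverse _).2 ?_, ?_⟩).elim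
        · cases e₁
          · exact hsink c hc he
          · trivial
          · trivial
        · cases e₃
          · exact hsink c' hc' he'
          · trivial
          · trivial
    · by_cases hvK : v ∈ K
      · exact (step hK hJ hL hJK.symm hKL hJL (fun h => Set.disjoint_left.1 hJK h hvK) hvL
          hsep.symm).symm
      · exact step hJ hK hL hJK hJL hKL hvK hvL hsep

end ADMG

end GlobalMarkov

namespace ADMG

variable {V : Type u} [Finite V] {X : V → Type} [∀ v, MeasurableSpace (X v)]
  [∀ v, StandardBorelSpace (X v)]

theorem EModel_subset_NEModel (G : ADMG V) : G.EModel X ⊆ G.NEModel X := by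
  rintro P ⟨f, ρ, hf, hP, hM, hρ⟩
  have := isProbabilityMeasure_of_map measurable_fst hP
  refine ⟨noiseLaw ρ, ?_, margV_noiseLaw ρ P hP⟩
  intro J K L hJK hJL hKL hsep
  rw [condIndepFun_iff_condIndep]
  refine coordCondIndep_of_determined (P := (noiseLaw ρ : Measure (∀ i, ExtSpace X V i)))
    (G := G.noiseExpansion) (E := Set.range Sum.inr) ?_ ?_ ?_ _ Set.univ (Set.subset_univ _)
    (fun _ _ _ _ => Set.mem_univ _) rfl J K L (Set.subset_univ _) (Set.subset_univ _)
    (Set.subset_univ _) hJK hJL hKL (separated_of_not_mConnected hsep)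
  · rintro _ ⟨j, rfl⟩ (k | k) h <;> exact h.elim
  · intro J K hJ hK hJK hbi
    change IndepFun (fun (x : ∀ i, ExtSpace X V i) (i : J) => x i)
      (fun (x : ∀ i, ExtSpace X V i) (i : K) => x i) (ρ.map joinNoise)
    rw [indepFun_map_iff measurable_joinNoise (by fun_prop) (by fun_prop)]
    have h0 := hM {j | Sum.inr j ∈ J} {k | Sum.inr k ∈ K}
      (Set.disjoint_left.2 fun j hj hk => Set.disjoint_left.1 hJK hj hk)
      (fun j hj k hk => hbi (.inr j) hj (.inr k) hk)
    rw [indepFun_map_iff measurable_snd (by fun_prop) (by fun_prop)] at h0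
    have key : ∀ S : Set (V ⊕ V), S ⊆ Set.range Sum.inr →
        ∃ φ : ({j | Sum.inr j ∈ S} → unitInterval) → ∀ i : S, ExtSpace X V i,
        Measurable φ ∧ ∀ z : (∀ v, X v) × (V → unitInterval),
          (fun i : S => joinNoise z i) = φ (fun j => z.2 j) := by
      intro S hS
      have hS' : ∀ v, Sum.inl v ∉ S := fun v hv => by simpa using hS hv
      refine ⟨fun y i => match i with
        | ⟨.inl v, hv⟩ => (hS' v hv).elim
        | ⟨.inr j, hj⟩ => y ⟨j, hj⟩, ?_, ?_⟩
      · refine measurable_pi_lambda _ ?_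
        rintro ⟨i | i, hi⟩
        · exact (hS' i hi).elim
        · exact measurable_pi_apply _
      · intro z
        funext i
        rcases i with ⟨i | i, hi⟩
        · exact (hS' i hi).elim
        · rfl
    obtain ⟨φ, hφ, hφ'⟩ := key J hJ
    obtain ⟨ψ, hψ, hψ'⟩ := key K hK
    have h1 := h0.comp hφ hψ
    simp only [Function.comp_def, ← hφ', ← hψ'] at h1
    exact h1
  · rintro (v | j) hv
    · let ψ : (∀ k : {k | G.noiseDir k (.inl v)}, ExtSpace X V k) → ExtSpace X V (.inl v) :=
        fun y => f v (fun k => y ⟨.inl k, k.2⟩, y ⟨.inr v, rfl⟩)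
      have hψ : Measurable ψ := by
        refine (hf v).comp (Measurable.prodMk (measurable_pi_lambda _ fun k => ?_) ?_)
        · exact measurable_pi_apply (X := fun k : {k | G.noiseDir k (.inl v)} => ExtSpace X V k)
            ⟨.inl k.1, k.2⟩
        · exact measurable_pi_apply (X := fun k : {k | G.noiseDir k (.inl v)} => ExtSpace X V k)
            ⟨.inr v, rfl⟩
      refine ⟨ψ, hψ, ?_⟩
      change ∀ᵐ x ∂(ρ.map joinNoise), x (.inl v) = ψ fun k => x k
      have hres : Measurable fun (x : ∀ i, ExtSpace X V i)
          (k : {k | G.noiseDir k (.inl v)}) => x k := by fun_prop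
      have hset : MeasurableSet {x : ∀ i, ExtSpace X V i | x (.inl v) = ψ fun k => x k} :=
        measurableSet_eq_fun (by fun_prop) (hψ.comp hres)
      rw [ae_map_iff measurable_joinNoise.aemeasurable hset]
      filter_upwards [hρ] with z hz
      exact hz v
    · exact absurd ⟨j, rfl⟩ hv

end ADMG

namespace ADMG

/-! ### Separations in the noise expansion -/

section Separations

variable {V : Type u} {G : ADMG V}

/-- A walk without colliders cannot leave the original vertices again. -/
theorem noiseExpansion_not_isWalk_inr {k : V} {w : List (EdgeKind × (V ⊕ V))} :
    ∀ {e : EdgeKind} {v : V}, e.HeadAtEnd → G.noiseExpansion.IsWalk (.inl v) w (.inr k) →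
      ¬ ((e, Sum.inl v) :: w).IsChain (fun s t => ¬ Collider s t) := by
  induction w with
  | nil => intro e v _ hw; cases hw
  | cons s w ih =>
    intro e v he hw hc
    obtain ⟨e', c⟩ := s
    obtain ⟨hs, hc⟩ := List.isChain_cons_cons.1 hc
    cases e' with
    | left => exact hs ⟨he, trivial⟩
    | both => exact hs ⟨he, trivial⟩
    | right =>
      rcases c with c | c
      · exact ih (e := .right) trivial hw.2 hc
      · exact hw.1

theorem not_mConnected_noise {J K : Set V} (hJK : Disjoint J K)
    (hbi : ∀ j ∈ J, ∀ k ∈ K, ¬ G.bi j k) :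
    ¬ G.noiseExpansion.MConnected (Sum.inr '' J) (Sum.inr '' K) ∅ := by
  rintro ⟨_, ⟨j, hj, rfl⟩, _, ⟨k, hk, rfl⟩, w, hw, hc⟩
  replace hc : w.IsChain (fun s t => ¬ Collider s t) := hc.imp fun _ _ h h' => h.1 h'
  rcases w with - | ⟨⟨e, c⟩, w⟩
  · cases hw
    exact Set.disjoint_left.1 hJK hj hk
  obtain ⟨he, hw⟩ := hw
  cases e with
  | left => rcases c with c | c <;> exact he.elim
  | right =>
    rcases c with c | c
    · exact noiseExpansion_not_isWalk_inr (e := .right) trivial hw hc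
    · exact he.elim
  | both =>
    rcases c with c | c
    · exact he.elim
    rcases w with - | ⟨⟨e', c'⟩, w⟩
    · cases hw
      exact hbi j hj _ hk he
    obtain ⟨hs, hc⟩ := List.isChain_cons_cons.1 hc
    cases e' with
    | left => exact hs ⟨trivial, trivial⟩
    | both => exact hs ⟨trivial, trivial⟩
    | right =>
      rcases c' with c' | c'
      · exact noiseExpansion_not_isWalk_inr (e := .right) trivial hw.2 hc
      · exact hw.1.elim

/-- An open walk that enters a descendant of `v` through an arrowhead runs through descendants of
`v` only, because the parents of `v` are not descendants of `v`. -/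
theorem noiseExpansion_isWalk_descendant {v : V} {b : V ⊕ V} {w : List (EdgeKind × (V ⊕ V))} :
    ∀ {e : EdgeKind} {x : V}, e.HeadAtEnd → Relation.ReflTransGen G.dir v x →
      G.noiseExpansion.IsWalk (.inl x) w b →
      ((e, Sum.inl x) :: w).IsChain (fun s t =>
        (Collider s t → s.2 ∈ {k | G.noiseExpansion.dir k (.inl v)}) ∧
        (¬ Collider s t → s.2 ∉ {k | G.noiseExpansion.dir k (.inl v)})) →
      ∃ y, b = .inl y ∧ Relation.ReflTransGen G.dir v y := by
  induction w with
  | nil => intro e x _ hx hw _; exact ⟨x, hw.symm, hx⟩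
  | cons s w ih =>
    intro e x he hx hw hc
    obtain ⟨e', c⟩ := s
    obtain ⟨hs, hc⟩ := List.isChain_cons_cons.1 hc
    have hnot : ¬ e'.HeadAtStart := fun h =>
      G.acyclic v (Relation.TransGen.tail' hx (hs.1 ⟨he, h⟩))
    cases e' with
    | left => exact (hnot trivial).elim
    | both => exact (hnot trivial).elim
    | right =>
      rcases c with c | c
      · exact ih (e := .right) trivial (hx.tail hw.1) hw.2 hc
      · exact hw.1.elim

/-- The local Markov property: a vertex is separated by its parents from its other
non-descendants. -/
theorem not_mConnected_parents {v : V} {K : Set (V ⊕ V)}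
    (hK : ∀ k ∈ K, ¬ G.noiseExpansion.dir k (.inl v))
    (hd : ∀ x, Sum.inl x ∈ K → ¬ Relation.ReflTransGen G.dir v x) :
    ¬ G.noiseExpansion.MConnected {.inl v} K {k | G.noiseExpansion.dir k (.inl v)} := by
  rintro ⟨_, rfl, k, hk, w, hw, hc⟩
  have key : ∀ {e : EdgeKind} {x : V} {w : List (EdgeKind × (V ⊕ V))}, e.HeadAtEnd →
      Relation.ReflTransGen G.dir v x → G.noiseExpansion.IsWalk (.inl x) w k →
      ¬ ((e, Sum.inl x) :: w).IsChain (fun s t =>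
        (Collider s t → s.2 ∈ {k | G.noiseExpansion.dir k (.inl v)}) ∧
        (¬ Collider s t → s.2 ∉ {k | G.noiseExpansion.dir k (.inl v)})) := by
    intro e x w he hx hw hc
    obtain ⟨y, rfl, hy⟩ := noiseExpansion_isWalk_descendant he hx hw hc
    exact hd y hk hy
  rcases w with - | ⟨⟨e, c⟩, w⟩
  · obtain rfl : Sum.inl v = k := hw
    exact hd v hk .refl
  obtain ⟨he, hw⟩ := hw
  cases e with
  | left =>
    rcases w with - | ⟨s, w⟩
    · obtain rfl : c = k := hw
      exact hK c hk he
    · exact (List.isChain_cons_cons.1 hc).1.2 (fun h => h.1) he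
  | right =>
    rcases c with c | c
    · exact key (e := .right) trivial (.single he) hw hc
    · exact he.elim
  | both =>
    rcases c with c | c
    · obtain rfl : v = c := he
      exact key (e := .both) trivial .refl hw hc
    · exact he.elim

end Separations

end ADMG

/-! ### Independence of combined noise -/

section ProductIndependence

variable {Ω Ω' α α' β β' : Type*} [MeasurableSpace Ω] [MeasurableSpace Ω'] [MeasurableSpace α]
  [MeasurableSpace α'] [MeasurableSpace β] [MeasurableSpace β']

theorem comap_prod_eq_generateFrom {γ : Type*} (h : γ → α × β) :
    MeasurableSpace.comap h inferInstance = MeasurableSpace.generateFrom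
      {u | ∃ r ∈ Set.image2 (· ×ˢ ·) {s : Set α | MeasurableSet s} {t : Set β | MeasurableSet t},
        h ⁻¹' r = u} := by
  rw [← generateFrom_prod, MeasurableSpace.comap_generateFrom]
  rfl

theorem ProbabilityTheory.IndepFun.prodMap {μ : Measure Ω} {ν : Measure Ω'}
    [IsProbabilityMeasure μ] [IsProbabilityMeasure ν] {f : Ω → α} {f' : Ω → α'} {g : Ω' → β}
    {g' : Ω' → β'} (hf : Measurable f) (hf' : Measurable f') (hg : Measurable g)
    (hg' : Measurable g') (h₁ : IndepFun f f' μ) (h₂ : IndepFun g g' ν) :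
    IndepFun (Prod.map f g) (Prod.map f' g') (μ.prod ν) := by
  rw [IndepFun_iff_Indep]
  refine IndepSets.indep (hf.prodMap hg).comap_le (hf'.prodMap hg').comap_le
    (isPiSystem_prod.comap _) (isPiSystem_prod.comap _)
    (comap_prod_eq_generateFrom _) (comap_prod_eq_generateFrom _) ?_
  rw [IndepSets_iff]
  rintro _ _ ⟨_, ⟨s, hs, t, ht, rfl⟩, rfl⟩ ⟨_, ⟨s', hs', t', ht', rfl⟩, rfl⟩
  have e₁ : Prod.map f g ⁻¹' (s ×ˢ t) = (f ⁻¹' s) ×ˢ (g ⁻¹' t) := rfl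
  have e₂ : Prod.map f' g' ⁻¹' (s' ×ˢ t') = (f' ⁻¹' s') ×ˢ (g' ⁻¹' t') := rfl
  simp only [e₁, e₂, Set.prod_inter_prod, Measure.prod_prod]
  rw [h₁.measure_inter_preimage_eq_mul s s' hs hs', h₂.measure_inter_preimage_eq_mul t t' ht ht']
  ring

theorem indepFun_restrict_pi {ι : Type*} [Fintype ι] {Z : ι → Type*} [∀ i, MeasurableSpace (Z i)]
    (ν : ∀ i, Measure (Z i)) [∀ i, IsProbabilityMeasure (ν i)] {J K : Set ι} (hJK : Disjoint J K) :
    IndepFun (fun (x : ∀ i, Z i) (j : J) => x j) (fun (x : ∀ i, Z i) (k : K) => x k)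
      (Measure.pi ν) := by
  classical
  have h := (iIndepFun_pi (μ := ν) (X := fun _ x => x) fun _ => aemeasurable_id).indepFun_finset
    (Set.toFinite J).toFinset (Set.toFinite K).toFinset
    (by simpa [Set.disjoint_toFinset] using hJK) (fun i => measurable_pi_apply i)
  exact h.comp
    (φ := fun (y : ∀ i : (Set.toFinite J).toFinset, Z i) (j : J) => y ⟨j, by simp⟩)
    (ψ := fun (y : ∀ i : (Set.toFinite K).toFinset, Z i) (k : K) => y ⟨k, by simp⟩)
    (by fun_prop) (by fun_prop)

/-- Functional representation of a kernel: the joint law of `A` and `g (A, U)` if `U` is an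
independent noise variable. -/
theorem map_prodMk_of_indepFun {μ : Measure Ω} [IsProbabilityMeasure μ] {A : Ω → α} {U : Ω → β}
    {g : α → β → α'} {κ : Kernel α α'} [IsMarkovKernel κ] (hA : Measurable A) (hU : Measurable U)
    (hg : Measurable (Function.uncurry g)) (hind : IndepFun A U μ)
    (hκ : ∀ a, (μ.map U).map (g a) = κ a) :
    μ.map (fun ω => (A ω, g (A ω) (U ω))) = (μ.map A) ⊗ₘ κ := by
  have hG : Measurable fun p : α × β => (p.1, g p.1 p.2) := measurable_fst.prodMk hg
  have h1 : μ.map (fun ω => (A ω, g (A ω) (U ω))) =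
      ((μ.map A).prod (μ.map U)).map fun p => (p.1, g p.1 p.2) := by
    rw [← (indepFun_iff_map_prod_eq_prod_map_map hA.aemeasurable hU.aemeasurable).1 hind,
      Measure.map_map hG (hA.prodMk hU)]
    rfl
  have : IsProbabilityMeasure (μ.map A) := Measure.isProbabilityMeasure_map hA.aemeasurable
  have : IsProbabilityMeasure (μ.map U) := Measure.isProbabilityMeasure_map hU.aemeasurable
  rw [h1]
  ext s hs
  rw [Measure.map_apply hG hs, Measure.prod_apply (hG hs), Measure.compProd_apply hs]
  refine lintegral_congr fun a => ?_
  have hga : Measurable (g a) := hg.comp measurable_prodMk_left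
  rw [← hκ a, Measure.map_apply hga (measurable_prodMk_left hs)]
  rfl

end ProductIndependence

/-- The projection `𝕍 × [0,1]^L → [0,1]^L`. -/
def restrictNoise {V : Type u} (X : V → Type) (L : Type u) (x : ∀ i, ExtSpace X L i) (l : L) :
    unitInterval := x (Sum.inr l)

theorem measurable_restrictNoise {V : Type u} (X : V → Type) [∀ v, MeasurableSpace (X v)]
    (L : Type u) : Measurable (restrictNoise X L) :=
  measurable_pi_lambda _ fun l => measurable_pi_apply (X := ExtSpace X L) (Sum.inr l)

namespace ADMG

/-! ### Functional representation of global Markov distributions -/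

section Sampling

variable {V : Type u} [Fintype V] {X : V → Type}

/-- The vector of all variables of the noise expansion that is generated by the noise `z.1` and by
randomization variables `z.2`: the variable of a vertex `v` of `G` is the value at `z.2 v` of a
function that depends on the parents of `v` in the noise expansion. -/
noncomputable def sample (G : ADMG V)
    (g : ∀ v, (∀ k : {k // G.noiseExpansion.dir k (.inl v)}, ExtSpace X V k) → unitInterval →
    ExtSpace X V (.inl v))
    (z : (V → unitInterval) × (V → unitInterval)) : ∀ i, ExtSpace X V i :=
  G.noiseExpansion.recSolution (A := (V → unitInterval) × (V → unitInterval))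
    (fun i p => match i, p with
      | .inl v, p => g v p.1 (p.2.2 v)
      | .inr j, p => p.2.1 j) z

variable {G : ADMG V}
  {g : ∀ v, (∀ k : {k // G.noiseExpansion.dir k (.inl v)}, ExtSpace X V k) → unitInterval →
    ExtSpace X V (.inl v)}

theorem sample_inl (z : (V → unitInterval) × (V → unitInterval)) (v : V) :
    G.sample g z (.inl v) = g v (fun k => G.sample g z k) (z.2 v) := by
  rw [sample, recSolution_eq]

theorem sample_inr (z : (V → unitInterval) × (V → unitInterval)) (j : V) :
    G.sample g z (.inr j) = z.1 j := by
  rw [sample, recSolution_eq]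

/-- The sampled variables in an ancestral set depend only on their own randomization variables. -/
theorem sample_congr {T : Set (V ⊕ V)} (hT : ∀ w ∈ T, ∀ p, G.noiseExpansion.dir p w → p ∈ T)
    {z z' : (V → unitInterval) × (V → unitInterval)} (h₁ : z.1 = z'.1)
    (h₂ : ∀ v, Sum.inl v ∈ T → z.2 v = z'.2 v) (i : V ⊕ V) (hi : i ∈ T) :
    G.sample g z i = G.sample g z' i := by
  induction i using G.noiseExpansion.wellFounded_dir.induction with
  | _ i ih =>
    rcases i with v | j
    · rw [sample_inl, sample_inl, h₂ v hi]
      congr 1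
      funext k
      exact ih k k.2 (hT _ hi _ k.2)
    · rw [sample_inr, sample_inr, h₁]

variable [∀ v, MeasurableSpace (X v)]

theorem measurable_sample (hg : ∀ v, Measurable (Function.uncurry (g v))) :
    Measurable (G.sample g) := by
  refine G.noiseExpansion.measurable_recSolution ?_
  rintro (v | j)
  · exact (hg v).comp (measurable_fst.prodMk
      ((measurable_pi_apply v).comp (measurable_snd.comp measurable_snd)))
  · exact (measurable_pi_apply j).comp (measurable_fst.comp measurable_snd)

/-- The joint distribution of a noise vector with law `Q` and of independent uniform randomization
variables. -/
noncomputable def randomized (Q : Measure (V → unitInterval)) :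
    Measure ((V → unitInterval) × (V → unitInterval)) :=
  Q.prod (Measure.pi fun _ => volume)

instance (Q : Measure (V → unitInterval)) [IsProbabilityMeasure Q] :
    IsProbabilityMeasure (randomized Q) := by
  unfold randomized
  infer_instance

theorem map_randomized_eval (Q : Measure (V → unitInterval)) [IsProbabilityMeasure Q] (v : V) :
    (randomized Q).map (fun z => z.2 v) = volume :=
  ((measurePreserving_eval (fun _ : V => (volume : Measure unitInterval)) v).comp
    (measurePreserving_snd (μ := Q))).map_eq

/-- The randomization variable of `v` is independent of the sampled variables in an ancestral set
that does not contain `v`. -/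
theorem indepFun_sample (hg : ∀ v, Measurable (Function.uncurry (g v)))
    (Q : Measure (V → unitInterval)) [IsProbabilityMeasure Q] {T : Set (V ⊕ V)}
    (hT : ∀ w ∈ T, ∀ p, G.noiseExpansion.dir p w → p ∈ T) {v : V} (hv : Sum.inl v ∉ T) :
    IndepFun (fun z (i : T) => G.sample g z i) (fun z => z.2 v) (randomized Q) := by
  classical
  have h0 : IndepFun (Prod.map id fun (u : V → unitInterval) (j : {j | j ≠ v}) => u j)
      (Prod.map (fun _ => ()) fun (u : V → unitInterval) (j : ({v} : Set V)) => u j)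
      (randomized Q) :=
    IndepFun.prodMap measurable_id measurable_const (by fun_prop) (by fun_prop)
      (indepFun_const_right _ _)
      (indepFun_restrict_pi _ (Set.disjoint_left.2 fun j hj hj' => hj hj'))
  let r : (V → unitInterval) × ({j | j ≠ v} → unitInterval) →
      (V → unitInterval) × (V → unitInterval) :=
    fun p => (p.1, fun j => if h : j = v then 0 else p.2 ⟨j, h⟩)
  have hr : Measurable r := by
    refine measurable_fst.prodMk (measurable_pi_lambda _ fun j => ?_)
    by_cases h : j = v
    · simp only [h, dif_pos]
      exact measurable_const
    · simp only [h, dif_neg, not_false_eq_true]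
      exact (measurable_pi_apply _).comp measurable_snd
  have hφ : Measurable fun p (i : T) => G.sample g (r p) i :=
    measurable_pi_lambda _ fun i =>
      (measurable_pi_apply (i : V ⊕ V)).comp ((measurable_sample hg).comp hr)
  have h1 := h0.comp hφ ((measurable_pi_apply (⟨v, rfl⟩ : ({v} : Set V))).comp measurable_snd)
  refine h1.congr (Filter.Eventually.of_forall fun z => ?_) (Filter.EventuallyEq.refl _ _)
  funext i
  symm
  refine sample_congr (g := g) (z := z) (z' := r (z.1, fun j => z.2 j)) hT rfl
    (fun w hw => ?_) i i.2
  have hwv : w ≠ v := fun h => hv (h ▸ hw)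
  simp [r, hwv]

variable [∀ v, StandardBorelSpace (X v)] {P : ProbabilityMeasure (∀ i, ExtSpace X V i)}

/-- If the functions `g v` represent the conditional distributions given the parents, then sampling
reproduces the global Markov distribution `P`. The sampled variables are added one by one, in
a topological order. -/
theorem map_sample (hP : P ∈ G.noiseExpansion.GMModel (ExtSpace X V))
    [∀ i, Nonempty (ExtSpace X V i)] (hg : ∀ v, Measurable (Function.uncurry (g v)))
    (hgP : ∀ v a, volume.map (g v a) = condDistrib (fun x : ∀ i, ExtSpace X V i => x (.inl v))
      (fun x (k : {k // G.noiseExpansion.dir k (.inl v)}) => x k)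
      (P : Measure (∀ i, ExtSpace X V i)) a)
    (n : ℕ) : ∀ T : Set (V ⊕ V), Set.range Sum.inr ⊆ T →
      (∀ w ∈ T, ∀ p, G.noiseExpansion.dir p w → p ∈ T) → (T \ Set.range Sum.inr).ncard = n →
      (randomized ((P : Measure (∀ i, ExtSpace X V i)).map (restrictNoise X V))).map
        (fun z (i : T) => G.sample g z i) =
      (P : Measure (∀ i, ExtSpace X V i)).map (fun x (i : T) => x i) := by
  classical
  set Q := (P : Measure (∀ i, ExtSpace X V i)).map (restrictNoise X V) with hQ
  have hinr := measurable_restrictNoise X V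
  have : IsProbabilityMeasure Q := Measure.isProbabilityMeasure_map hinr.aemeasurable
  have hs : Measurable (G.sample g) := measurable_sample hg
  induction n with
  | zero =>
    intro T hET _ hn
    obtain rfl : T = Set.range Sum.inr :=
      (Set.sdiff_eq_empty.1 ((Set.ncard_eq_zero (Set.toFinite _)).1 hn)).antisymm hET
    let φ : (V → unitInterval) → ∀ i : Set.range (Sum.inr : V → V ⊕ V), ExtSpace X V i :=
      fun e i => match i with
        | ⟨.inr j, _⟩ => e j
        | ⟨.inl v, hv⟩ => absurd hv (by simp)
    have hφ : Measurable φ := by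
      refine measurable_pi_lambda _ ?_
      rintro ⟨_, ⟨j, rfl⟩⟩
      exact measurable_pi_apply j
    have h1 : (fun z (i : Set.range (Sum.inr : V → V ⊕ V)) => G.sample g z i) =
        fun z => φ z.1 := by
      funext z ⟨_, ⟨j, rfl⟩⟩
      exact sample_inr z j
    have h2 : (fun (x : ∀ i, ExtSpace X V i) (i : Set.range (Sum.inr : V → V ⊕ V)) => x i) =
        fun x => φ (restrictNoise X V x) := by
      funext x ⟨_, ⟨j, rfl⟩⟩
      rfl
    have h3 : (randomized Q).map Prod.fst = Q := (measurePreserving_fst (μ := Q)).map_eq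
    rw [h1, h2]
    calc (randomized Q).map (fun z => φ z.1) = ((randomized Q).map Prod.fst).map φ :=
          (Measure.map_map hφ measurable_fst).symm
      _ = _ := by
          rw [h3, hQ, Measure.map_map hφ hinr]
          rfl
  | succ n ihn =>
    intro T hET hT hn
    obtain ⟨v', ⟨hvT, hvE⟩, hmax⟩ :=
      G.noiseExpansion.wellFounded_swap_transGen_dir.has_min (T \ Set.range Sum.inr)
        ((Set.ncard_pos (Set.toFinite _)).1 (by omega))
    obtain v | j := v'
    swap
    · exact absurd ⟨j, rfl⟩ hvE
    have hsink : ∀ w ∈ T, ¬ G.noiseExpansion.dir (.inl v) w := by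
      rintro (w | w) hw h
      · exact hmax (.inl w) ⟨hw, by simp⟩ (.single h)
      · exact h
    have hT' : ∀ w ∈ T \ {.inl v}, ∀ p, G.noiseExpansion.dir p w → p ∈ T \ {Sum.inl v} :=
      fun w hw p hp => ⟨hT w hw.1 p hp, fun h => hsink w hw.1 (h ▸ hp)⟩
    have IH := ihn (T \ {.inl v}) (fun w hw => ⟨hET hw, fun h => hvE (h ▸ hw)⟩) hT' (by
      have : (T \ {Sum.inl v}) \ Set.range Sum.inr = (T \ Set.range Sum.inr) \ {Sum.inl v} :=
        Set.sdiff_sdiff_comm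
      rw [this, Set.ncard_sdiff_singleton_of_mem
        (show Sum.inl v ∈ T \ Set.range Sum.inr from ⟨hvT, hvE⟩), hn, Nat.add_sub_cancel])
    have hpa : ∀ k, G.noiseExpansion.dir k (.inl v) → k ∈ T \ {Sum.inl v} := fun k hk =>
      ⟨hT _ hvT k hk, fun h => G.noiseExpansion.acyclic _ (.single (h ▸ hk))⟩
    let K : Set (V ⊕ V) := {k ∈ T \ {.inl v} | ¬ G.noiseExpansion.dir k (.inl v)}
    -- The parents of `v`, and the other variables that precede `v`.
    let B : (∀ i, ExtSpace X V i) →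
        (∀ k : {k // G.noiseExpansion.dir k (.inl v)}, ExtSpace X V k) ×
          (∀ k : K, ExtSpace X V k) :=
      fun x => (fun k => x k, fun k => x k)
    have hB : Measurable B := by fun_prop
    let split : (∀ i : ↥(T \ {Sum.inl v}), ExtSpace X V i) →
        (∀ k : {k // G.noiseExpansion.dir k (.inl v)}, ExtSpace X V k) ×
          (∀ k : K, ExtSpace X V k) :=
      fun y => (fun k => y ⟨k, hpa k k.2⟩, fun k => y ⟨k, k.2.1⟩)
    have hsplit : Measurable split := by fun_prop
    let glue : ((∀ k : {k // G.noiseExpansion.dir k (.inl v)}, ExtSpace X V k) ×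
        (∀ k : K, ExtSpace X V k)) × ExtSpace X V (.inl v) → ∀ i : T, ExtSpace X V i :=
      fun p i => if h : (i : V ⊕ V) = .inl v then h.symm ▸ p.2 else
        if h' : G.noiseExpansion.dir i (.inl v) then p.1.1 ⟨i, h'⟩ else p.1.2 ⟨i, ⟨i.2, h⟩, h'⟩
    have hglue : Measurable glue := by
      refine measurable_pi_lambda _ ?_
      rintro ⟨i, hi⟩
      by_cases h : i = .inl v
      · subst h
        simp only [glue, dif_pos]
        exact measurable_snd
      · by_cases h' : G.noiseExpansion.dir i (.inl v)
        · simp only [glue, h, h', dif_pos, dif_neg, not_false_eq_true]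
          exact (measurable_pi_apply _).comp (measurable_fst.comp measurable_fst)
        · simp only [glue, h, h', dif_neg, not_false_eq_true]
          exact (measurable_pi_apply _).comp (measurable_snd.comp measurable_fst)
    have hgB : ∀ x : ∀ i, ExtSpace X V i, (fun i : T => x i) = glue (B x, x (.inl v)) := by
      intro x
      funext ⟨i, hi⟩
      by_cases h : i = .inl v
      · subst h
        simp [glue]
      · by_cases h' : G.noiseExpansion.dir i (.inl v) <;> simp [glue, h, h', B]
    -- The local Markov property identifies the conditional distribution of the variable of `v`.
    have hci := hP {.inl v} K {k | G.noiseExpansion.dir k (.inl v)}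
      (Set.disjoint_singleton_left.2 fun h => h.1.2 rfl)
      (Set.disjoint_singleton_left.2 fun h => G.noiseExpansion.acyclic (.inl v) (.single h))
      (Set.disjoint_left.2 fun k hk hk' => hk.2 hk')
      (not_mConnected_parents (fun k hk => hk.2) (by
        intro x hx hvx
        rcases Relation.reflTransGen_iff_eq_or_transGen.1 hvx with rfl | hvx
        · exact hx.1.2 rfl
        · exact hmax (.inl x) ⟨hx.1.1, by simp⟩ (hvx.lift Sum.inl fun _ _ h => h)))
    have hci' := (hci.comp (φ := fun y => y ⟨.inl v, rfl⟩) (ψ := id)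
      (measurable_pi_apply (X := fun j : ({.inl v} : Set (V ⊕ V)) => ExtSpace X V j) ⟨.inl v, rfl⟩)
      measurable_id).symm
    have hk : Measurable fun (x : ∀ i, ExtSpace X V i)
        (k : {k // G.noiseExpansion.dir k (.inl v)}) => x k := by fun_prop
    have hPv := (condDistrib_ae_eq_iff_measure_eq_compProd _
      (measurable_pi_apply (Sum.inl v)).aemeasurable _).1
      ((condIndepFun_iff_condDistrib_prod_ae_eq_prodMkRight
        (f := fun x : ∀ i, ExtSpace X V i => x (.inl v)) (g := fun x (k : K) => x k)
        (measurable_pi_apply _) (by fun_prop) hk).1 hci')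
    have hindB : IndepFun (fun z => B (G.sample g z)) (fun z => z.2 v) (randomized Q) :=
      (indepFun_sample hg Q hT' (v := v) (fun h => h.2 rfl)).comp hsplit measurable_id
    have hsv := map_prodMk_of_indepFun (A := fun z => B (G.sample g z)) (U := fun z => z.2 v)
      (g := fun a => g v a.1)
      (κ := (condDistrib (fun x : ∀ i, ExtSpace X V i => x (.inl v))
        (fun x (k : {k // G.noiseExpansion.dir k (.inl v)}) => x k)
        (P : Measure (∀ i, ExtSpace X V i))).prodMkRight _)
      (hB.comp hs) (by fun_prop)
      ((hg v).comp ((measurable_fst.comp measurable_fst).prodMk measurable_snd)) hindB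
      (fun a => by rw [map_randomized_eval, hgP, Kernel.prodMkRight_apply])
    have hmapB : (randomized Q).map (fun z => B (G.sample g z)) =
        (P : Measure (∀ i, ExtSpace X V i)).map B := by
      have := congrArg (Measure.map split) IH
      rwa [Measure.map_map hsplit (by fun_prop), Measure.map_map hsplit (by fun_prop)] at this
    have hpair : (randomized Q).map (fun z => (B (G.sample g z), G.sample g z (.inl v))) =
        (P : Measure (∀ i, ExtSpace X V i)).map fun x => (B x, x (.inl v)) := by
      simp only [sample_inl]
      refine hsv.trans ?_
      rw [hmapB]
      exact hPv.symm
    have := congrArg (Measure.map glue) hpair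
    rw [Measure.map_map hglue (by fun_prop), Measure.map_map hglue (by fun_prop)] at this
    rw [show (fun z (i : T) => G.sample g z i) =
      fun z => glue (B (G.sample g z), G.sample g z (.inl v)) from funext fun z => hgB _,
      show (fun (x : ∀ i, ExtSpace X V i) (i : T) => x i) = fun x => glue (B x, x (.inl v)) from
        funext hgB]
    exact this

/-- Under a global Markov distribution of the noise expansion, the noise is unconditionally
Markov. -/
theorem noiseMarkov_of_mem_GMModel (hP : P ∈ G.noiseExpansion.GMModel (ExtSpace X V)) :
    G.NoiseMarkov ((P : Measure (∀ i, ExtSpace X V i)).map (restrictNoise X V)) := by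
  intro J K hJK hbi
  have hinr := measurable_restrictNoise X V
  rw [indepFun_map_iff hinr (by fun_prop) (by fun_prop)]
  have hci := hP (Sum.inr '' J) (Sum.inr '' K) ∅
    ((Set.disjoint_image_iff Sum.inr_injective).2 hJK) (Set.disjoint_empty _)
    (Set.disjoint_empty _) (not_mConnected_noise hJK hbi)
  have hbot : MeasurableSpace.comap (fun (x : ∀ i, ExtSpace X V i) (l : (∅ : Set (V ⊕ V))) => x l)
      inferInstance = ⊥ := by
    have := coordSigma_eq_iSup (Y := ExtSpace X V) ∅
    simpa using this
  rw [condIndepFun_iff_condIndep] at hci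
  have hind : IndepFun (fun (x : ∀ i, ExtSpace X V i) (i : (Sum.inr '' J : Set (V ⊕ V))) => x i)
      (fun (x : ∀ i, ExtSpace X V i) (i : (Sum.inr '' K : Set (V ⊕ V))) => x i)
      (P : Measure (∀ i, ExtSpace X V i)) := by
    rw [IndepFun_iff_Indep]
    refine indep_of_condIndep_bot (Measurable.comap_le (by fun_prop))
      (Measurable.comap_le (by fun_prop)) ?_
    convert hci using 1
    exact hbot.symm
  exact hind.comp
    (φ := fun y (j : J) => (y ⟨.inr j, Set.mem_image_of_mem _ j.2⟩ : unitInterval))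
    (ψ := fun y (k : K) => (y ⟨.inr k, Set.mem_image_of_mem _ k.2⟩ : unitInterval))
    (measurable_pi_lambda _ fun j => measurable_pi_apply
      (X := fun i : (Sum.inr '' J : Set (V ⊕ V)) => ExtSpace X V i) ⟨.inr j, _⟩)
    (measurable_pi_lambda _ fun k => measurable_pi_apply
      (X := fun i : (Sum.inr '' K : Set (V ⊕ V)) => ExtSpace X V i) ⟨.inr k, _⟩)

/-- The noise variable of a structural equation encodes the noise variable of the noise expansion
and the randomization variable. -/
theorem NEModel_subset_EModel : G.NEModel X ⊆ G.EModel X := by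
  rintro _ ⟨P, hP, rfl⟩
  obtain ⟨x₀⟩ := (P : Measure (∀ i, ExtSpace X V i)).nonempty_of_neZero
  have hne : ∀ i, Nonempty (ExtSpace X V i) := fun i => ⟨x₀ i⟩
  have hrep : ∀ v, ∃ g : (∀ k : {k // G.noiseExpansion.dir k (.inl v)}, ExtSpace X V k) →
      unitInterval → ExtSpace X V (.inl v), Measurable (Function.uncurry g) ∧
      ∀ a, volume.map (g a) = condDistrib (fun x : ∀ i, ExtSpace X V i => x (.inl v))
        (fun x (k : {k // G.noiseExpansion.dir k (.inl v)}) => x k)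
        (P : Measure (∀ i, ExtSpace X V i)) a :=
    fun v => Kernel.exists_measurable_map_eq_unitInterval _
  choose g hg hgP using hrep
  have hs : Measurable (G.sample g) := measurable_sample hg
  set Q := (P : Measure (∀ i, ExtSpace X V i)).map (restrictNoise X V) with hQ
  have hQP : IsProbabilityMeasure Q := Measure.isProbabilityMeasure_map
    (measurable_restrictNoise X V).aemeasurable
  have hlaw : (randomized Q).map (G.sample g) = P := by
    have h := map_sample hP hg hgP _ Set.univ (Set.subset_univ _)
      (fun _ _ _ _ => Set.mem_univ _) rfl
    have hu : Measurable fun (y : ∀ i : (Set.univ : Set (V ⊕ V)), ExtSpace X V i) (i : V ⊕ V) =>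
        y ⟨i, Set.mem_univ i⟩ := by fun_prop
    have := congrArg (Measure.map fun y i => y ⟨i, Set.mem_univ i⟩) h
    rw [Measure.map_map hu (by fun_prop), Measure.map_map hu (by fun_prop)] at this
    exact this.trans Measure.map_id
  obtain ⟨enc, dec, henc, hdec, hde⟩ := exists_unitInterval_encoding (unitInterval × unitInterval)
  let η : (V → unitInterval) × (V → unitInterval) → V → unitInterval :=
    fun z j => enc (z.1 j, z.2 j)
  have hη : Measurable η := by fun_prop
  let par : ∀ j, (∀ k : {k // G.dir k j}, X k) × unitInterval →
      ∀ k : {k // G.noiseExpansion.dir k (.inl j)}, ExtSpace X V k :=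
    fun j p k => match k with
      | ⟨.inl k, hk⟩ => p.1 ⟨k, hk⟩
      | ⟨.inr _, _⟩ => (dec p.2).1
  have hpar : ∀ j, Measurable (par j) := by
    refine fun j => measurable_pi_lambda _ ?_
    rintro ⟨k | k, hk⟩
    · exact (measurable_pi_apply _).comp measurable_fst
    · exact measurable_fst.comp (hdec.comp measurable_snd)
  let f : ∀ j, (∀ k : {k // G.dir k j}, X k) × unitInterval → X j :=
    fun j p => g j (par j p) (dec p.2).2
  have hf : ∀ j, Measurable (f j) := fun j =>
    (hg j).comp ((hpar j).prodMk (measurable_snd.comp (hdec.comp measurable_snd)))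
  have hF : Measurable fun z => (restrictObserved X V (G.sample g z), η z) :=
    ((measurable_restrictObserved X V).comp hs).prodMk hη
  refine ⟨f, (randomized Q).map fun z => (restrictObserved X V (G.sample g z), η z), hf, ?_, ?_, ?_⟩
  · change _ = (P : Measure (∀ i, ExtSpace X V i)).map (restrictObserved X V)
    rw [Measure.map_map measurable_fst hF, ← hlaw,
      Measure.map_map (measurable_restrictObserved X V) hs]
    rfl
  · have h : ((randomized Q).map fun z => (restrictObserved X V (G.sample g z), η z)).map Prod.snd =
        (randomized Q).map η := by
      rw [Measure.map_map measurable_snd hF]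
      rfl
    rw [h]
    intro J K hJK hbi
    rw [indepFun_map_iff hη (by fun_prop) (by fun_prop)]
    have h0 : IndepFun
        (Prod.map (fun (e : V → unitInterval) (j : J) => e j)
          (fun (u : V → unitInterval) (j : J) => u j))
        (Prod.map (fun (e : V → unitInterval) (k : K) => e k)
          (fun (u : V → unitInterval) (k : K) => u k)) (randomized Q) :=
      IndepFun.prodMap (by fun_prop) (by fun_prop) (by fun_prop) (by fun_prop)
        (noiseMarkov_of_mem_GMModel hP J K hJK hbi) (indepFun_restrict_pi _ hJK)
    exact h0.comp (φ := fun p j => enc (p.1 j, p.2 j)) (ψ := fun p k => enc (p.1 k, p.2 k))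
      (by fun_prop) (by fun_prop)
  · rw [ae_map_iff hF.aemeasurable (measurableSet_solution G hf)]
    refine Filter.Eventually.of_forall fun z j => ?_
    change G.sample g z (.inl j) = _
    rw [sample_inl]
    simp only [f, η, hde]
    congr 1
    funext ⟨k, hk⟩
    rcases k with k | k
    · rfl
    · obtain rfl : k = j := hk
      simp only [par, hde]
      exact sample_inr z k

theorem NEModel_eq_EModel : G.NEModel X = G.EModel X :=
  NEModel_subset_EModel.antisymm G.EModel_subset_NEModel

end Sampling

end ADMG

/-! ### Completeness with respect to expansions -/

theorem margV_image_sep {V L : Type u} {X : V → Type} [∀ v, MeasurableSpace (X v)]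
    (M : Set (ProbabilityMeasure (∀ i, ExtSpace X L i)))
    (D : ProbabilityMeasure (∀ v, X v) → Prop) :
    margV '' {P' ∈ M | D (margV P')} = {P ∈ margV '' M | D P} := by
  ext P
  constructor
  · rintro ⟨P', ⟨hP', hD⟩, rfl⟩
    exact ⟨⟨P', hP', rfl⟩, hD⟩
  · rintro ⟨⟨P', hP', rfl⟩, hD⟩
    exact ⟨P', ⟨hP', hD⟩, rfl⟩

theorem mainTheorem4 {V : Type u} [Fintype V] (G : ADMG V) (X : V → Type)
    [∀ v, MeasurableSpace (X v)] [∀ v, StandardBorelSpace (X v)] :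
    -- all probability distributions
    (G.EModel X = margV '' G.noiseExpansion.EModel (ExtSpace X V) ∧
      G.EModel X = {P | ∃ (L : Type u) (_ : Fintype L), ∃ G' ∈ G.unconfoundedExpansions L,
        P ∈ margV '' G'.EModel (ExtSpace X L)} ∧
      G.EModel X = {P | ∃ (L : Type u) (_ : Fintype L), ∃ G' ∈ G.expansions L,
        P ∈ margV '' G'.EModel (ExtSpace X L)} ∧
      G.NEModel X = {P | ∃ (L : Type u) (_ : Fintype L), ∃ G' ∈ G.unconfoundedExpansions L,
        P ∈ margV '' G'.NEModel (ExtSpace X L)}) ∧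
    -- only those under which the observed vector has a density
    ∀ (μ : ∀ v, Measure (X v)) [∀ v, SigmaFinite (μ v)],
      {P ∈ G.EModel X | HasDensity μ P} =
        margV '' {P' ∈ G.noiseExpansion.EModel (ExtSpace X V) | HasDensity μ (margV P')} ∧
      {P ∈ G.EModel X | HasDensity μ P} =
        {P | ∃ (L : Type u) (_ : Fintype L), ∃ G' ∈ G.unconfoundedExpansions L,
          P ∈ margV '' {P' ∈ G'.EModel (ExtSpace X L) | HasDensity μ (margV P')}} ∧
      {P ∈ G.EModel X | HasDensity μ P} =
        {P | ∃ (L : Type u) (_ : Fintype L), ∃ G' ∈ G.expansions L,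
          P ∈ margV '' {P' ∈ G'.EModel (ExtSpace X L) | HasDensity μ (margV P')}} ∧
      {P ∈ G.NEModel X | HasDensity μ P} =
        {P | ∃ (L : Type u) (_ : Fintype L), ∃ G' ∈ G.unconfoundedExpansions L,
          P ∈ margV '' {P' ∈ G'.NEModel (ExtSpace X L) | HasDensity μ (margV P')}} := by
  have h₁ : G.EModel X = margV '' G.noiseExpansion.EModel (ExtSpace X V) := by
    refine G.EModel_subset_margV_noiseExpansion.antisymm ?_
    rintro _ ⟨P, hP, rfl⟩
    exact ADMG.margV_mem_EModel G.noiseExpansion_mem_unconfoundedExpansions.1 hP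
  have hmem : ∀ P ∈ G.EModel X, ∃ (L : Type u) (_ : Fintype L), ∃ G' ∈ G.unconfoundedExpansions L,
      P ∈ margV '' G'.EModel (ExtSpace X L) := fun P hP =>
    ⟨V, inferInstance, G.noiseExpansion, G.noiseExpansion_mem_unconfoundedExpansions, h₁ ▸ hP⟩
  have hexp : ∀ P, (∃ (L : Type u) (_ : Fintype L), ∃ G' ∈ G.expansions L,
      P ∈ margV '' G'.EModel (ExtSpace X L)) → P ∈ G.EModel X := by
    rintro _ ⟨L, _, G', hG', P, hP, rfl⟩
    exact ADMG.margV_mem_EModel hG' hP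
  have h₂ : G.EModel X = {P | ∃ (L : Type u) (_ : Fintype L), ∃ G' ∈ G.unconfoundedExpansions L,
      P ∈ margV '' G'.EModel (ExtSpace X L)} :=
    Set.Subset.antisymm hmem fun P ⟨L, hL, G', hG', hP⟩ => hexp P ⟨L, hL, G', hG'.1, hP⟩
  have h₃ : G.EModel X = {P | ∃ (L : Type u) (_ : Fintype L), ∃ G' ∈ G.expansions L,
      P ∈ margV '' G'.EModel (ExtSpace X L)} :=
    Set.Subset.antisymm (fun P hP => by
      obtain ⟨L, hL, G', hG', hP'⟩ := hmem P hP
      exact ⟨L, hL, G', hG'.1, hP'⟩) hexp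
  simp only [ADMG.NEModel_eq_EModel, margV_image_sep]
  refine ⟨⟨h₁, h₂, h₃, h₂⟩, fun μ _ => ?_⟩
  have h₂' : {P ∈ G.EModel X | HasDensity μ P} =
      {P | ∃ (L : Type u) (_ : Fintype L), ∃ G' ∈ G.unconfoundedExpansions L,
        P ∈ {P ∈ margV '' G'.EModel (ExtSpace X L) | HasDensity μ P}} := by
    rw [h₂]
    ext P
    exact ⟨fun ⟨⟨L, hL, G', hG', hP⟩, hD⟩ => ⟨L, hL, G', hG', hP, hD⟩,
      fun ⟨L, hL, G', hG', hP, hD⟩ => ⟨⟨L, hL, G', hG', hP⟩, hD⟩⟩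
  refine ⟨by rw [← h₁], h₂', ?_, h₂'⟩
  rw [h₃]
  ext P
  exact ⟨fun ⟨⟨L, hL, G', hG', hP⟩, hD⟩ => ⟨L, hL, G', hG', hP, hD⟩,
    fun ⟨L, hL, G', hG', hP, hD⟩ => ⟨⟨L, hL, G', hG', hP⟩, hD⟩⟩
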